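/- Let $S_\infty=\bigcup_n S_n$ be the group of permutations of $\{1,2,3,\dots\}$ that fix all but finitely many letters, and for $w\in S_\infty$ let $\ell(w)$ be its number of inversions. The Schubert polynomial of $w$ is $$\mathfrak S_w=\sum_{a}\ \sum_{(i_1,\dots,i_p)}x_{i_1}\cdots x_{i_p}\in\mathbb Z[x_1,x_2,\dots],\qquad p=\ell(w),$$ where $a=(a_1,\dots,a_p)$ runs over the reduced words of $w$ ($w=s_{a_1}\cdots s_{a_p}$ with $s_b$ the transposition of $b$ and $b+1$) and $(i_1,\dots,i_p)$ over the sequences of positive integers with $i_1\le\cdots\le i_p$, $i_t\le a_t$ for all $t$, and $i_t<i_{t+1}$ whenever $a_t<a_{t+1}$. For $k\ge 0$ let $1^k\times w\in S_\infty$ be the permutation that fixes $1,\dots,k$ and sends $k+p$ to $k+w(p)$ for $p\ge1$ (so $1\times w=1^1\times w$), and let $e_i^k=\sum_{1\le r_1<\cdots<r_i\le k}x_{r_1}\cdots x_{r_i}$. Lemma. Let $0\le i\le j$ be integers and let $w\in S_\infty$. For every $k\ge 0$ there is a unique expansion $$e_i^{\,j+k}\,\mathfrak S_{1^k\times w}=\sum_{v\in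 S_\infty}\beta^{(k)}_v\,\mathfrak S_v$$ with integer coefficients, only finitely many of them nonzero. Put $W_0=\{v:\beta^{(0)}_v\ne0\}$ and, for $k\ge1$, let $$W_k=\{v:\beta^{(k)}_v\neq 0\}\setminus\{1\times u:\beta^{(k-1)}_u\ne0\}$$ be the set of new permutations in the $k$-th expansion compared to the $(k-1)$-st. These expansions have the strong stable property: 1. For all $k\ge0$ and $v\in S_\infty$ we have $\beta^{(k+1)}_{1\times v}=\beta^{(k)}_v$, and $v(1)\ne1$ for all $v\in W_k$ with $k\ge1$. 2. There exists an integer $r\ge0$ such that $W_s\ne\emptyset$ for $1\le s\le r$, $W_s=\emptyset$ for all $s>r$, and for all $k\ge r$ $$e_i^{\,j+k}\,\mathfrak S_{1^k\times w}=\sum_{s=0}^{r}\ \sum_{v\in W_s}\beta^{(s)}_v\,\mathfrak S_{1^{k-s}\times v}.$$ -/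

import Mathlib

/-- The infinite symmetric group `S_∞ = ⋃ₙ Sₙ`: the permutations of `ℕ` that fix all but finitely
many numbers. Positions and values are counted from `0`, so the letter `p` of `{1, 2, 3, …}` is
represented by `p - 1`. -/
def SInf : Type :=
  {w : Equiv.Perm ℕ // ∃ N, ∀ p, N ≤ p → w p = p}

namespace SInf

/-- The length of a permutation: its number of inversions. -/
noncomputable def length (w : SInf) : ℕ :=
  Set.ncard {pq : ℕ × ℕ | pq.1 < pq.2 ∧ w.1 pq.2 < w.1 pq.1}

/-- The set `R(w)` of reduced words `a₁ ⋯ a_p` of `w`, i.e. `w = s_{a₁} ⋯ s_{a_p}` with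
`p = ℓ(w)`, where `s_a` is the transposition of `a` and `a + 1`. -/
def reducedWords (w : SInf) : Set (List ℕ) :=
  {a | (a.map fun b => Equiv.swap b (b + 1)).prod = w.1 ∧ a.length = w.length}

/-- The set `K(a)` of `a`-compatible sequences. -/
def compatible (a : List ℕ) : Set (List ℕ) :=
  {b | b.length = a.length ∧
    (∀ t, t + 1 < a.length → b.getD t 0 ≤ b.getD (t + 1) 0) ∧
    (∀ t, t < a.length → b.getD t 0 ≤ a.getD t 0) ∧
    (∀ t, t + 1 < a.length → a.getD t 0 < a.getD (t + 1) 0 →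
      b.getD t 0 < b.getD (t + 1) 0)}

/-- The Schubert polynomial
`𝔖_w = ∑_{a ∈ R(w)} ∑_{(i₁, …, i_p) ∈ K(a)} x_{i₁} ⋯ x_{i_p}` (both sums are finite). -/
noncomputable def schubert (w : SInf) : MvPolynomial ℕ ℤ :=
  ∑ᶠ (a : List ℕ) (_ : a ∈ w.reducedWords), ∑ᶠ (b : List ℕ) (_ : b ∈ compatible a),
    (b.map MvPolynomial.X).prod

/-- The permutation `1ᵏ × w`: it fixes the first `k` letters and acts as `w`, shifted by `k`, on
the remaining ones. -/
def onePow (k : ℕ) (w : SInf) : SInf :=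
  ⟨{ toFun := fun p => if p < k then p else w.1 (p - k) + k
     invFun := fun p => if p < k then p else w.1.symm (p - k) + k
     left_inv := by
       intro p
       by_cases h : p < k
       · simp [h]
       · simp [h]; omega
     right_inv := by
       intro p
       by_cases h : p < k
       · simp [h]
       · simp [h]; omega },
   by
     obtain ⟨N, hN⟩ := w.2
     refine ⟨N + k, fun p hp => ?_⟩
     have h1 : ¬ p < k := by omega
     have h2 := hN (p - k) (by omega)
     simp only [Equiv.coe_fn_mk, h1, if_false, h2]
     omega⟩

end SInf

/-- The elementary symmetric polynomial `e_i^k` of degree `i` in the first `k` variables. -/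
noncomputable def elemSym (i k : ℕ) : MvPolynomial ℕ ℤ :=
  ∑ t ∈ (Finset.range k).powersetCard i, ∏ p ∈ t, MvPolynomial.X p

/-- `c` is the family of coefficients of an expansion of `f` into Schubert polynomials. -/
def IsSchubertExpansion (f : MvPolynomial ℕ ℤ) (c : SInf →₀ ℤ) : Prop :=
  f = ∑ v ∈ c.support, MvPolynomial.C (c v) * v.schubert

open Classical in
/-- Given the coefficients `c k` of the `k`-th expansion, `newPerms c 0` is the set of permutations
in the `0`-th expansion, and `newPerms c k` for `k ≥ 1` is the set of new permutations in the
`k`-th expansion compared to the `(k - 1)`-st, i.e. those not of the form `1 × u` with `u` in the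
`(k - 1)`-st expansion. -/
noncomputable def newPerms (c : ℕ → SInf →₀ ℤ) : ℕ → Finset SInf
  | 0 => (c 0).support
  | k + 1 => (c (k + 1)).support \ (c k).support.image (SInf.onePow 1)

/-! Expand `e_i^{j+k} 𝔖_{1ᵏ×w}` in the Schubert basis. Stability: the substitution `dropVar` (set
the first variable to `0`, shift the others down) sends `𝔖_{1×u}` to `𝔖_u`, kills `𝔖_v` when `v`
moves the first letter, and sends `e_i^{m+1}` to `e_i^m`. Hence for `k ≥ 1` the new permutations are
exactly those moving the first letter (`mem_newPerms_succ`), and the `k`-th expansion is a sum of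
shifted layers. It remains to see that the positive `k` with `HasNew i j w k` form an interval `1,
…, r`.

Lowering (`HasNew.exists_pred`): Pieri's rule is written as a product of operators, one for each
value, with the value `0` acting last. A new permutation in step `k + 1` therefore comes from a
permutation `1 × y` in the expansion for `e_{i-1}` by a cover exchanging the first letter with a
position `b ≥ j + k + 1`. If `k ≥ 1`, the cover condition at the second position forces `y` to move
its first letter, so `y` is new in step `k` for `i - 1`. Iterating gives the bound `k ≤ i`
(`HasNew.le`).

Raising (`HasNew.succ_left`): `nabla = ∑ ∂/∂x_k` sends `e_{i+1}^m` to `(m - i) e_i^m`, and `𝔖_u` to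
a nonnegative combination that stays among permutations fixing the first letter if `u` does. As all
coefficients are nonnegative, a new permutation for `e_i^m` with `i < m` forces one for `e_{i+1}^m`.
Lowering followed by raising takes step `k + 1` to step `k` at the same `i` (`HasNew.pred`).

The foundations are the nilCoxeter factorization of Schubert polynomials, the resulting divided
difference formula `schubert_sub_swapVar`, Monk's rule by uniqueness under divided differences, and
Pieri's rule from Monk's by an exchange relation (`one_add_monkOp_mul`). -/

namespace SInf

/-! ### Permutations, length, covers and reduced words. -/

/-- Right multiplication of a permutation by the transposition of the positions `a` and `b`. -/
def mulSwap (w : SInf) (a b : ℕ) : SInf :=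
  ⟨w.1 * Equiv.swap a b, by
    obtain ⟨N, hN⟩ := w.2
    refine ⟨max N (max (a + 1) (b + 1)), fun p hp => ?_⟩
    have h1 : p ≠ a := by omega
    have h2 : p ≠ b := by omega
    rw [Equiv.Perm.mul_apply, Equiv.swap_apply_of_ne_of_ne h1 h2]
    exact hN p (by omega)⟩

/-- The identity permutation. -/
def id : SInf := ⟨1, 0, fun _ _ => rfl⟩

theorem id_apply (p : ℕ) : id.1 p = p := rfl

theorem ext_apply {v w : SInf} (h : ∀ p, v.1 p = w.1 p) : v = w :=
  Subtype.ext (Equiv.ext h)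

theorem mulSwap_apply (w : SInf) (a b p : ℕ) :
    (w.mulSwap a b).1 p = w.1 (Equiv.swap a b p) := rfl

theorem mulSwap_left (w : SInf) (a b : ℕ) : (w.mulSwap a b).1 a = w.1 b := by
  rw [mulSwap_apply, Equiv.swap_apply_left]

theorem mulSwap_right (w : SInf) (a b : ℕ) : (w.mulSwap a b).1 b = w.1 a := by
  rw [mulSwap_apply, Equiv.swap_apply_right]

theorem mulSwap_of_ne (w : SInf) {a b p : ℕ} (ha : p ≠ a) (hb : p ≠ b) :
    (w.mulSwap a b).1 p = w.1 p := by
  rw [mulSwap_apply, Equiv.swap_apply_of_ne_of_ne ha hb]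

theorem mulSwap_mulSwap (w : SInf) (a b : ℕ) : (w.mulSwap a b).mulSwap a b = w :=
  ext_apply fun p => by simp [mulSwap_apply]

theorem mulSwap_ite (w : SInf) (a b p : ℕ) :
    (w.mulSwap a b).1 p = if p = a then w.1 b else if p = b then w.1 a else w.1 p := by
  rw [mulSwap_apply, Equiv.swap_apply_def]
  split_ifs <;> rfl

theorem finite_inversions (w : SInf) :
    {pq : ℕ × ℕ | pq.1 < pq.2 ∧ w.1 pq.2 < w.1 pq.1}.Finite := by
  obtain ⟨N, hN⟩ := w.2
  have key : ∀ p, p < N → w.1 p < N := by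
    intro p hp
    by_contra h
    have := hN _ (not_lt.1 h)
    exact h ((w.1.injective this).symm ▸ hp)
  refine ((Set.finite_Iio N).prod (Set.finite_Iio N)).subset ?_
  rintro ⟨p, q⟩ ⟨h1, h2⟩
  simp only at h1 h2
  have hq : q < N := by
    by_contra h
    rw [hN q (not_lt.1 h)] at h2
    by_cases hp : p < N
    · have := key p hp
      omega
    · rw [hN p (not_lt.1 hp)] at h2
      omega
  exact ⟨lt_trans h1 hq, hq⟩

theorem length_mulSwap_of_lt (w : SInf) {a : ℕ} (h : w.1 a < w.1 (a + 1)) :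
    (w.mulSwap a (a + 1)).length = w.length + 1 := by
  have hset : {pq : ℕ × ℕ | pq.1 < pq.2 ∧ (w.mulSwap a (a + 1)).1 pq.2
        < (w.mulSwap a (a + 1)).1 pq.1} =
      insert (a, a + 1) (Set.image
        (fun pq : ℕ × ℕ => (Equiv.swap a (a + 1) pq.1, Equiv.swap a (a + 1) pq.2))
        {pq : ℕ × ℕ | pq.1 < pq.2 ∧ w.1 pq.2 < w.1 pq.1}) := by
    ext ⟨p, q⟩
    simp only [Set.mem_ofPred_eq, Set.mem_insert_iff, Set.mem_image, Prod.mk.injEq, Prod.exists,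
      mulSwap_apply]
    constructor
    · rintro ⟨h1, h2⟩
      by_cases hpq : p = a ∧ q = a + 1
      · exact Or.inl hpq
      · refine Or.inr ⟨_, _, ⟨?_, h2⟩, by simp, by simp⟩
        simp only [Equiv.swap_apply_def]
        split_ifs <;> omega
    · rintro (⟨rfl, rfl⟩ | ⟨p', q', ⟨h1, h2⟩, rfl, rfl⟩)
      · simpa using h
      · simp only [Equiv.swap_apply_self]
        refine ⟨?_, h2⟩
        have hne : ¬ (p' = a ∧ q' = a + 1) := by
          rintro ⟨rfl, rfl⟩
          omega
        simp only [Equiv.swap_apply_def]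
        split_ifs <;> omega
  rw [length, hset, Set.ncard_insert_of_notMem _ (w.finite_inversions.image _),
    Set.ncard_image_of_injective, length]
  · rintro ⟨p, q⟩ ⟨p', q'⟩ hh
    simpa using hh
  · rintro ⟨⟨p, q⟩, ⟨h1, h2⟩, hh⟩
    simp only [Prod.mk.injEq] at hh h1
    have e1 : p = a + 1 := by
      rw [← Equiv.swap_apply_self a (a + 1) p, hh.1, Equiv.swap_apply_left]
    have e2 : q = a := by
      rw [← Equiv.swap_apply_self a (a + 1) q, hh.2, Equiv.swap_apply_right]
    omega

theorem length_mulSwap_of_gt (w : SInf) {a : ℕ} (h : w.1 (a + 1) < w.1 a) :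
    (w.mulSwap a (a + 1)).length + 1 = w.length := by
  have := length_mulSwap_of_lt (w.mulSwap a (a + 1)) (a := a)
    (by rwa [mulSwap_left, mulSwap_right])
  rw [mulSwap_mulSwap] at this
  exact this.symm

theorem apply_ne (w : SInf) {p q : ℕ} (h : p ≠ q) : w.1 p ≠ w.1 q := fun e => h (w.1.injective e)

theorem ascent_or_descent (w : SInf) (a : ℕ) : w.1 a < w.1 (a + 1) ∨ w.1 (a + 1) < w.1 a :=
  lt_or_gt_of_ne (w.apply_ne (by omega))

theorem length_id : id.length = 0 := by
  rw [length]
  convert Set.ncard_empty (ℕ × ℕ)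
  ext ⟨p, q⟩
  simp only [Set.mem_ofPred_eq, id_apply, Set.mem_empty_iff_false, iff_false]
  omega

theorem exists_descent (w : SInf) (hw : w ≠ id) : ∃ a, w.1 (a + 1) < w.1 a := by
  by_contra! h
  apply hw
  have hmono : StrictMono w.1 := strictMono_nat_of_lt_succ fun a =>
    lt_of_le_of_ne (h a) (w.apply_ne (by omega))
  obtain ⟨N, hN⟩ := w.2
  apply ext_apply
  intro p
  rw [id_apply]
  apply le_antisymm _ (hmono.le_apply)
  have key : ∀ d, w.1 p + d ≤ w.1 (p + d) := by
    intro d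
    induction d with
    | zero => simp
    | succ d ih =>
      have := hmono (show p + d < p + (d + 1) by omega)
      omega
  have h1 := key N
  rw [hN (p + N) (by omega)] at h1
  omega

/-- Induction on permutations: every permutation other than the identity is obtained from a shorter
one by exchanging two adjacent positions. -/
theorem induction_descent {P : SInf → Prop}
    (h : ∀ w : SInf, (∀ a, w.1 (a + 1) < w.1 a → P (w.mulSwap a (a + 1))) → P w) (w : SInf) :
    P w := by
  generalize hn : w.length = n
  induction n using Nat.strong_induction_on generalizing w with
  | _ n ih =>
    refine h w fun a ha => ih _ ?_ _ rfl
    have := length_mulSwap_of_gt w ha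
    omega

/-- `w t_{ab}` covers `w` in the Bruhat order. -/
def Cov (w : SInf) (a b : ℕ) : Prop :=
  a < b ∧ w.1 a < w.1 b ∧ ∀ p, a < p → p < b → w.1 p < w.1 a ∨ w.1 b < w.1 p

/-- Induction on `b - a`: conjugation by `s_a` turns the cover at `(a, b)` into one at `(a + 1, b)`.
Since `w (a + 1)` lies outside the interval from `w a` to `w b`, the two adjacent swaps change the
length in opposite directions. -/
theorem Cov.length {w : SInf} {a b : ℕ} (h : w.Cov a b) :
    (w.mulSwap a b).length = w.length + 1 := by
  obtain ⟨d, rfl⟩ : ∃ d, b = a + 1 + d := ⟨b - (a + 1), by have := h.1; omega⟩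
  induction d generalizing w a with
  | zero => exact length_mulSwap_of_lt w h.2.1
  | succ d ih =>
    obtain ⟨h1, h2, h3⟩ := h
    set b := a + 1 + (d + 1) with hb
    have hcov : (w.mulSwap a (a + 1)).Cov (a + 1) b := by
      refine ⟨by omega, ?_, fun p hp hp' => ?_⟩
      · rwa [mulSwap_right, mulSwap_of_ne _ (by omega) (by omega)]
      · rw [mulSwap_right, mulSwap_of_ne _ (by omega) (by omega),
          mulSwap_of_ne _ (by omega) (by omega)]
        exact h3 p (by omega) hp'
    have hb' : b = a + 1 + 1 + d := by omega
    have hlen := ih (a := a + 1) (w := w.mulSwap a (a + 1)) (by rw [← hb']; exact hcov)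
    rw [← hb'] at hlen
    have heq : w.mulSwap a b = ((w.mulSwap a (a + 1)).mulSwap (a + 1) b).mulSwap a (a + 1) := by
      apply ext_apply
      intro p
      simp only [mulSwap_ite]
      split_ifs <;> first | rfl | omega | congr 1
    have hl : ((w.mulSwap a (a + 1)).mulSwap (a + 1) b).1 a = w.1 (a + 1) := by
      rw [mulSwap_of_ne _ (by omega) (by omega), mulSwap_left]
    have hr : ((w.mulSwap a (a + 1)).mulSwap (a + 1) b).1 (a + 1) = w.1 b := by
      rw [mulSwap_left, mulSwap_of_ne _ (by omega) (by omega)]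
    rcases h3 (a + 1) (by omega) (by omega) with h | h
    · have e1 := length_mulSwap_of_gt w h
      have e2 := length_mulSwap_of_lt ((w.mulSwap a (a + 1)).mulSwap (a + 1) b) (a := a)
        (by rw [hl, hr]; omega)
      rw [heq]
      omega
    · have e1 := length_mulSwap_of_lt w (a := a) (by omega)
      have e2 := length_mulSwap_of_gt ((w.mulSwap a (a + 1)).mulSwap (a + 1) b) (a := a)
        (by rw [hl, hr]; omega)
      rw [heq]
      omega

theorem prod_swap_append (l : List ℕ) (a : ℕ) :
    ((l ++ [a]).map fun b => Equiv.swap b (b + 1)).prod =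
      (l.map fun b => Equiv.swap b (b + 1)).prod * Equiv.swap a (a + 1) := by
  simp

theorem length_le_of_prod (l : List ℕ) (w : SInf)
    (h : (l.map fun b => Equiv.swap b (b + 1)).prod = w.1) : w.length ≤ l.length := by
  induction l using List.reverseRecOn generalizing w with
  | nil =>
    have : w = id := Subtype.ext h.symm
    rw [this, length_id]
    simp
  | append_singleton l a ih =>
    rw [prod_swap_append] at h
    have h1 := ih (w.mulSwap a (a + 1)) (by
      change _ = w.1 * Equiv.swap a (a + 1)
      rw [← h, mul_assoc, Equiv.swap_mul_self, mul_one])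
    rw [List.length_append, List.length_singleton]
    rcases w.ascent_or_descent a with h2 | h2
    · have := length_mulSwap_of_lt w h2
      omega
    · have := length_mulSwap_of_gt w h2
      omega

theorem nil_mem_reducedWords (w : SInf) : [] ∈ w.reducedWords ↔ w = id := by
  constructor
  · exact fun h => Subtype.ext h.1.symm
  · rintro rfl
    exact ⟨rfl, length_id.symm⟩

/-- This recursion on the last letter is the one by which `nilOp` acts, and so links reduced words
to the nilCoxeter product. -/
theorem append_mem_reducedWords (w : SInf) (l : List ℕ) (a : ℕ) :
    l ++ [a] ∈ w.reducedWords ↔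
      w.1 (a + 1) < w.1 a ∧ l ∈ (w.mulSwap a (a + 1)).reducedWords := by
  have hiff : ((l.map fun b => Equiv.swap b (b + 1)).prod * Equiv.swap a (a + 1) = w.1) ↔
      ((l.map fun b => Equiv.swap b (b + 1)).prod = (w.mulSwap a (a + 1)).1) := by
    change _ ↔ _ = w.1 * Equiv.swap a (a + 1)
    constructor
    · intro h
      rw [← h, mul_assoc, Equiv.swap_mul_self, mul_one]
    · intro h
      rw [h, mul_assoc, Equiv.swap_mul_self, mul_one]
  simp only [reducedWords, Set.mem_ofPred_eq]
  rw [prod_swap_append, hiff, List.length_append, List.length_singleton]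
  constructor
  · rintro ⟨h1, h2⟩
    have h3 := length_le_of_prod _ _ h1
    rcases w.ascent_or_descent a with h4 | h4
    · have := length_mulSwap_of_lt w h4
      omega
    · have := length_mulSwap_of_gt w h4
      exact ⟨h4, h1, by omega⟩
  · rintro ⟨h4, h1, h2⟩
    have := length_mulSwap_of_gt w h4
    exact ⟨h1, by omega⟩

/-- `w` lies in the symmetric group on the first `N` letters. -/
def Fixes (N : ℕ) (w : SInf) : Prop := ∀ p, N ≤ p → w.1 p = p

theorem Fixes.mono {N N' : ℕ} {w : SInf} (h : w.Fixes N) (hN : N ≤ N') : w.Fixes N' :=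
  fun p hp => h p (by omega)

theorem Fixes.apply_lt {N : ℕ} {w : SInf} (h : w.Fixes N) {p : ℕ} (hp : p < N) : w.1 p < N := by
  by_contra h'
  exact h' ((w.1.injective (h _ (not_lt.1 h'))).symm ▸ hp)

theorem Fixes.descent_lt {N : ℕ} {w : SInf} (h : w.Fixes N) {a : ℕ} (ha : w.1 (a + 1) < w.1 a) :
    a + 1 < N := by
  by_contra h'
  rw [h (a + 1) (by omega)] at ha
  by_cases h2 : a < N
  · have := h.apply_lt h2
    omega
  · rw [h a (by omega)] at ha
    omega

theorem Fixes.mulSwap {N : ℕ} {w : SInf} (h : w.Fixes N) {a b : ℕ} (ha : a < N) (hb : b < N) :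
    (w.mulSwap a b).Fixes N := fun p hp => by
  rw [mulSwap_of_ne _ (by omega) (by omega)]
  exact h p hp

theorem Fixes.reducedWords_lt {N : ℕ} {w : SInf} (h : w.Fixes N) {l : List ℕ}
    (hl : l ∈ w.reducedWords) : ∀ a ∈ l, a < N := by
  induction l using List.reverseRecOn generalizing w with
  | nil => simp
  | append_singleton l a ih =>
    rw [append_mem_reducedWords] at hl
    have h1 := h.descent_lt hl.1
    have h2 := ih (h.mulSwap (by omega) h1) hl.2
    intro b hb
    rw [List.mem_append, List.mem_singleton] at hb
    rcases hb with hb | rfl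
    · exact h2 b hb
    · omega

/-! ### The nilCoxeter algebra and commuting rows. -/

section NilCoxeter

variable {R A : Type*} [CommRing R] [Ring A] [Algebra R A]

/-- The factor `1 + x u` of the nilCoxeter algebra. -/
def nilFactor (u : ℕ → A) (a : ℕ) (x : R) : A := 1 + x • u a

/-- The product of the factors `1 + x u_a` for `i ≤ a < i + d`, in increasing order of `a`. -/
def nilRow (u : ℕ → A) : ℕ → ℕ → R → A
  | _, 0, _ => 1
  | i, d + 1, x => nilFactor u i x * nilRow u (i + 1) d x

/-- The relations of the nilCoxeter algebra of `S_∞`. -/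
structure IsNilCoxeter (u : ℕ → A) : Prop where
  sq : ∀ a, u a * u a = 0
  comm : ∀ a b, a + 2 ≤ b → u a * u b = u b * u a
  braid : ∀ a, u a * u (a + 1) * u a = u (a + 1) * u a * u (a + 1)

theorem IsNilCoxeter.factor_mul {u : ℕ → A} (hu : IsNilCoxeter u) (a : ℕ) (x y : R) :
    nilFactor u a x * nilFactor u a y = nilFactor u a (x + y) := by
  simp only [nilFactor, mul_add, add_mul, one_mul, mul_one, smul_mul_assoc, mul_smul_comm, hu.sq,
    smul_zero, add_zero, add_smul]
  abel

theorem nilFactor_zero (u : ℕ → A) (a : ℕ) : nilFactor u a (0 : R) = 1 := by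
  simp [nilFactor]

theorem IsNilCoxeter.yangBaxter {u : ℕ → A} (hu : IsNilCoxeter u) (a : ℕ) (x y : R) :
    nilFactor u a x * nilFactor u (a + 1) (x + y) * nilFactor u a y =
      nilFactor u (a + 1) y * nilFactor u a (x + y) * nilFactor u (a + 1) x := by
  have h1 := hu.sq a
  have h2 := hu.sq (a + 1)
  have h3 := hu.braid a
  have e : ∀ (p q : A), p * p = 0 → q * q = 0 → p * q * p = q * p * q →
      (1 + x • p) * (1 + (x + y) • q) * (1 + y • p) =
        (1 + y • q) * (1 + (x + y) • p) * (1 + x • q) := by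
    intro p q hp hq hpq
    simp only [mul_add, add_mul, one_mul, mul_one, smul_mul_assoc, mul_smul_comm, hp, hq, hpq,
      smul_zero, add_zero, add_smul, smul_add, smul_smul]
    module
  exact e _ _ h1 h2 h3

theorem IsNilCoxeter.commute_factor_row {u : ℕ → A} (hu : IsNilCoxeter u) {a i : ℕ} (d : ℕ)
    (h : a + 2 ≤ i) (x : R) : Commute (u a) (nilRow u i d x) := by
  induction d generalizing i with
  | zero => exact Commute.one_right _
  | succ d ih =>
    refine Commute.mul_right ?_ (ih (by omega))
    exact (Commute.one_right _).add_right (Commute.smul_right (hu.comm a i h) x)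

/-- Factors of the letter `i` slide past the letters from `i + 2` on, which reduces the claim to the
next shorter rows and a prefix of four factors in the letters `i`, `i + 1`. The Yang–Baxter relation
makes this prefix symmetric in the two parameters. -/
theorem IsNilCoxeter.row_commute {u : ℕ → A} (hu : IsNilCoxeter u) (d i : ℕ) (x y : R) :
    Commute (nilRow u i d x) (nilRow u i d y) := by
  induction d generalizing i with
  | zero => exact Commute.one_right _
  | succ d ih =>
    cases d with
    | zero =>
      simp only [nilRow, mul_one, Commute, SemiconjBy]
      rw [hu.factor_mul, hu.factor_mul, add_comm]
    | succ d =>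
      have hc : ∀ s t : R, Commute (nilFactor u i s) (nilRow u (i + 1 + 1) d t) := fun s t =>
        (Commute.one_left _).add_left
          (Commute.smul_left (hu.commute_factor_row d (by omega) t) s)
      have hrow : ∀ t : R, nilRow u (i + 1 + 1) d t =
          nilFactor u (i + 1) (-t) * nilRow u (i + 1) (d + 1) t := fun t => by
        rw [nilRow, ← mul_assoc, hu.factor_mul, neg_add_cancel, nilFactor_zero, one_mul]
      have key : ∀ s t : R, nilRow u i (d + 1 + 1) s * nilRow u i (d + 1 + 1) t =
          (nilFactor u i s * nilFactor u (i + 1) s * nilFactor u i t * nilFactor u (i + 1) (-s)) *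
            (nilRow u (i + 1) (d + 1) s * nilRow u (i + 1) (d + 1) t) := fun s t => by
        calc nilRow u i (d + 1 + 1) s * nilRow u i (d + 1 + 1) t
            = nilFactor u i s * nilFactor u (i + 1) s *
                (nilRow u (i + 1 + 1) d s * nilFactor u i t) * nilRow u (i + 1) (d + 1) t := by
              simp only [nilRow, mul_assoc]
          _ = nilFactor u i s * nilFactor u (i + 1) s * nilFactor u i t *
                nilRow u (i + 1 + 1) d s * nilRow u (i + 1) (d + 1) t := by
              rw [← (hc t s).eq]
              simp only [mul_assoc]
          _ = _ := by
              rw [hrow s]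
              simp only [mul_assoc]
      have hyb : ∀ s t : R,
          nilFactor u i s * nilFactor u (i + 1) s * nilFactor u i t * nilFactor u (i + 1) (-s) =
          nilFactor u i t * nilFactor u (i + 1) t * nilFactor u i s * nilFactor u (i + 1) (-t) :=
          fun s t => by
        have h := hu.yangBaxter i (s - t) t
        have e1 : nilFactor u i s = nilFactor u i t * nilFactor u i (s - t) := by
          rw [hu.factor_mul, add_sub_cancel]
        have e2 : nilFactor u (i + 1) (-t) =
            nilFactor u (i + 1) (s - t) * nilFactor u (i + 1) (-s) := by
          rw [hu.factor_mul]
          congr 1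
          ring
        rw [sub_add_cancel] at h
        calc _ = nilFactor u i t * (nilFactor u i (s - t) * nilFactor u (i + 1) s *
              nilFactor u i t) * nilFactor u (i + 1) (-s) := by
              rw [e1]
              simp only [mul_assoc]
          _ = _ := by
              rw [h, e2]
              simp only [mul_assoc]
      rw [Commute, SemiconjBy, key, key, hyb, (ih (i + 1)).eq]

end NilCoxeter

/-! ### The nilCoxeter action on functions and its divided differences. -/

section Functions

variable {R : Type*} [CommRing R]

/-- The action of the nilCoxeter generator `u_a` on coefficient functions. -/
def nilOp (R : Type*) [CommRing R] (a : ℕ) : Module.End R (SInf → R) where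
  toFun g w := if w.1 (a + 1) < w.1 a then g (w.mulSwap a (a + 1)) else 0
  map_add' g g' := by
    ext w
    by_cases h : w.1 (a + 1) < w.1 a <;> simp [h]
  map_smul' r g := by
    ext w
    by_cases h : w.1 (a + 1) < w.1 a <;> simp [h]

theorem nilOp_apply (a : ℕ) (g : SInf → R) (w : SInf) :
    nilOp R a g w = if w.1 (a + 1) < w.1 a then g (w.mulSwap a (a + 1)) else 0 := rfl

theorem isNilCoxeter_nilOp : IsNilCoxeter (nilOp R) where
  sq a := by
    ext g w
    simp only [Module.End.mul_apply, nilOp_apply, mulSwap_left, mulSwap_right, LinearMap.zero_apply,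
      Pi.zero_apply]
    split_ifs <;> first | rfl | omega
  comm a b h := by
    ext g w
    have h1 : (w.mulSwap a (a + 1)).mulSwap b (b + 1) =
        (w.mulSwap b (b + 1)).mulSwap a (a + 1) := by
      apply ext_apply
      intro p
      simp only [mulSwap_ite]
      split_ifs <;> first | rfl | omega
    have e1 := w.mulSwap_of_ne (show b ≠ a by omega) (show b ≠ a + 1 by omega)
    have e2 := w.mulSwap_of_ne (show b + 1 ≠ a by omega) (show b + 1 ≠ a + 1 by omega)
    have e3 := w.mulSwap_of_ne (show a ≠ b by omega) (show a ≠ b + 1 by omega)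
    have e4 := w.mulSwap_of_ne (show a + 1 ≠ b by omega) (show a + 1 ≠ b + 1 by omega)
    simp only [Module.End.mul_apply, nilOp_apply, e1, e2, e3, e4, h1]
    split_ifs <;> rfl
  braid a := by
    ext g w
    have h1 : ((w.mulSwap a (a + 1)).mulSwap (a + 1) (a + 1 + 1)).mulSwap a (a + 1) =
        ((w.mulSwap (a + 1) (a + 1 + 1)).mulSwap a (a + 1)).mulSwap (a + 1) (a + 1 + 1) := by
      apply ext_apply
      intro p
      simp only [mulSwap_ite]
      split_ifs <;> first | rfl | omega
    simp only [Module.End.mul_apply, nilOp_apply, h1]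
    simp only [mulSwap_ite]
    simp only [Nat.succ_ne_self, if_true, if_false,
      show a + 1 + 1 ≠ a by omega, show a ≠ a + 1 by omega, show a ≠ a + 1 + 1 by omega,
      show a + 1 ≠ a + 1 + 1 by omega]
    split_ifs <;> rfl

/-- The product of the rows `0, …, k - 1`, row `i` having the parameter `x i` and the letters
`i, …, n - 1`. -/
def nilRows (n : ℕ) (x : ℕ → R) : ℕ → Module.End R (SInf → R)
  | 0 => 1
  | k + 1 => nilRow (nilOp R) k (n - k) (x k) * nilRows n x k

theorem nilFactor_apply (a : ℕ) (x : R) (g : SInf → R) (w : SInf) :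
    nilFactor (nilOp R) a x g w =
      g w + x * if w.1 (a + 1) < w.1 a then g (w.mulSwap a (a + 1)) else 0 := rfl

theorem map_nilFactor (σ : R →+* R) (a : ℕ) (x : R) (g : SInf → R) :
    σ ∘ nilFactor (nilOp R) a x g = nilFactor (nilOp R) a (σ x) (σ ∘ g) := by
  ext w
  simp only [Function.comp_apply, nilFactor_apply]
  split_ifs <;> simp

theorem map_nilRow (σ : R →+* R) (i d : ℕ) (x : R) (g : SInf → R) :
    σ ∘ nilRow (nilOp R) i d x g = nilRow (nilOp R) i d (σ x) (σ ∘ g) := by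
  induction d generalizing i with
  | zero => rfl
  | succ d ih =>
    simp only [nilRow, Module.End.mul_apply]
    rw [map_nilFactor, ih]

theorem map_nilRows (σ : R →+* R) (n k : ℕ) (x : ℕ → R) (g : SInf → R) :
    σ ∘ nilRows n x k g = nilRows n (σ ∘ x) k (σ ∘ g) := by
  induction k with
  | zero => rfl
  | succ k ih =>
    simp only [nilRows, Module.End.mul_apply]
    rw [map_nilRow, ih]
    rfl

theorem nilRows_congr (n : ℕ) {x y : ℕ → R} {k : ℕ} (h : ∀ i < k, x i = y i) :
    nilRows n x k = nilRows n y k := by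
  induction k with
  | zero => rfl
  | succ k ih =>
    simp only [nilRows]
    rw [ih fun i hi => h i (by omega), h k (by omega)]

/-- Divided difference formula for the truncated generating function of Schubert polynomials. -/
theorem nilRows_sub (n : ℕ) (x : ℕ → R) (σ : R →+* R) (e : SInf → R) (he : σ ∘ e = e) (i : ℕ)
    (h1 : σ (x i) = x (i + 1)) (h2 : σ (x (i + 1)) = x i)
    (h3 : ∀ k, k ≠ i → k ≠ i + 1 → σ (x k) = x k) (k : ℕ) (hi : i < n) (hk : i + 2 ≤ k) :
    nilRows n x k e - σ ∘ nilRows n x k e =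
      (x i - x (i + 1)) • nilOp R i (nilRows n x k e) := by
  have hu := isNilCoxeter_nilOp (R := R)
  induction k, hk using Nat.le_induction with
  | succ k hk ih =>
    simp only [nilRows, Module.End.mul_apply]
    rw [map_nilRow, h3 k (by omega) (by omega), ← map_sub, ih, map_smul]
    congr 1
    -- Row `k ≥ i + 2` only involves letters that commute with `u_i`.
    exact congrArg (fun T => T (nilRows n x k e))
      (hu.commute_factor_row (n - k) (show i + 2 ≤ k by omega) (x k)).eq.symm
  | base =>
    -- Row `i + 1` is completed by the letter `i`, at the price of a factor with parameter `-x (i +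
    -- 1)`. The two completed rows commute, so `Q` is invariant under exchanging `x i` and `x (i +
    -- 1)`, and only the extra factor contributes to the difference.
    set Q := nilRow (nilOp R) i (n - i) (x (i + 1)) (nilRow (nilOp R) i (n - i) (x i)
      (nilRows n x i e)) with hQ
    have hσ : σ ∘ nilRows n x i e = nilRows n x i e := by
      rw [map_nilRows, he, nilRows_congr n (x := σ ∘ x) (y := x)]
      intro j hj
      exact h3 j (by omega) (by omega)
    have hQσ : σ ∘ Q = Q := by
      rw [hQ, map_nilRow, map_nilRow, hσ, h1, h2]
      exact congrArg (fun T => T (nilRows n x i e)) (hu.row_commute (n - i) i (x i) (x (i + 1))).eq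
    have hrow : nilRows n x (i + 2) e = nilFactor (nilOp R) i (-x (i + 1)) Q := by
      obtain ⟨d, hd⟩ : ∃ d, n - i = d + 1 := ⟨n - i - 1, by omega⟩
      have hd' : n - (i + 1) = d := by omega
      have : nilFactor (nilOp R) i (-x (i + 1)) * nilRow (nilOp R) i (n - i) (x (i + 1)) =
          nilRow (nilOp R) (i + 1) (n - (i + 1)) (x (i + 1)) := by
        rw [hd, hd', nilRow, ← mul_assoc, hu.factor_mul, neg_add_cancel, nilFactor_zero, one_mul]
      simp only [nilRows, Module.End.mul_apply]
      rw [← this]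
      rfl
    have hsq : nilOp R i (nilOp R i Q) = 0 :=
      congrArg (fun T => T Q) (hu.sq i)
    rw [hrow, map_nilFactor, hQσ]
    simp only [nilFactor, LinearMap.add_apply, LinearMap.smul_apply, Module.End.one_apply, map_add,
      map_smul, hsq, map_neg, h2]
    module

end Functions

/-! ### Schubert polynomials as coefficients of the nilCoxeter product. -/

open MvPolynomial

/-- The order in which the pairs (row, letter) enter the generating function: rows increase, and
letters decrease within a row. -/
def pairLT (p q : ℕ × ℕ) : Prop := p.1 < q.1 ∨ (p.1 = q.1 ∧ q.2 < p.2)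

instance : Trans pairLT pairLT pairLT where
  trans {p q r} h1 h2 := by
    unfold pairLT at *
    omega

instance : Std.Antisymm pairLT where
  antisymm p q h1 h2 := by
    unfold pairLT at *
    omega

/-- The pairs `(r, a)` for `i ≤ a < i + d`, in decreasing order of `a`. -/
def rowList (r : ℕ) : ℕ → ℕ → List (ℕ × ℕ)
  | _, 0 => []
  | i, d + 1 => rowList r (i + 1) d ++ [(r, i)]

/-- The pairs `(r, a)` for `r < k` and `r ≤ a < n`, in the order `pairLT`. -/
def gridList (n : ℕ) : ℕ → List (ℕ × ℕ)
  | 0 => []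
  | k + 1 => gridList n k ++ rowList k k (n - k)

theorem mem_rowList {r i d : ℕ} {p : ℕ × ℕ} :
    p ∈ rowList r i d ↔ p.1 = r ∧ i ≤ p.2 ∧ p.2 < i + d := by
  obtain ⟨s, a⟩ := p
  induction d generalizing i with
  | zero =>
    simp only [rowList, List.not_mem_nil, false_iff]
    omega
  | succ d ih =>
    simp only [rowList, List.mem_append, ih, List.mem_singleton, Prod.mk.injEq]
    omega

theorem mem_gridList {n k : ℕ} {p : ℕ × ℕ} :
    p ∈ gridList n k ↔ p.1 < k ∧ p.1 ≤ p.2 ∧ p.2 < n := by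
  obtain ⟨s, a⟩ := p
  induction k with
  | zero => simp [gridList]
  | succ k ih =>
    simp only [gridList, List.mem_append, ih, mem_rowList]
    omega

theorem pairwise_rowList (r i d : ℕ) : (rowList r i d).Pairwise pairLT := by
  induction d generalizing i with
  | zero => exact List.Pairwise.nil
  | succ d ih =>
    rw [rowList, List.pairwise_append]
    refine ⟨ih _, List.pairwise_singleton _ _, fun p hp q hq => ?_⟩
    rw [mem_rowList] at hp
    rw [List.mem_singleton] at hq
    subst hq
    unfold pairLT
    simp only
    omega

theorem pairwise_gridList (n k : ℕ) : (gridList n k).Pairwise pairLT := by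
  induction k with
  | zero => exact List.Pairwise.nil
  | succ k ih =>
    rw [gridList, List.pairwise_append]
    refine ⟨ih, pairwise_rowList _ _ _, fun p hp q hq => ?_⟩
    rw [mem_gridList] at hp
    rw [mem_rowList] at hq
    unfold pairLT
    omega

theorem nodup_of_pairwise {l : List (ℕ × ℕ)} (h : l.Pairwise pairLT) : l.Nodup :=
  h.imp fun {p q} hpq e => by
    subst e
    unfold pairLT at hpq
    omega

theorem sublist_gridList {n k : ℕ} {l : List (ℕ × ℕ)} :
    l.Sublist (gridList n k) ↔
      l.Pairwise pairLT ∧ ∀ p ∈ l, p.1 < k ∧ p.1 ≤ p.2 ∧ p.2 < n := by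
  constructor
  · exact fun h => ⟨(pairwise_gridList n k).sublist h, fun p hp => mem_gridList.1 (h.subset hp)⟩
  · rintro ⟨h1, h2⟩
    exact List.sublist_of_subperm_of_pairwise (r := pairLT)
      ((nodup_of_pairwise h1).subperm fun p hp => mem_gridList.2 (h2 p hp)) h1
      (pairwise_gridList n k)

open Classical in
/-- The sum of `x_{i₁} ⋯ x_{i_p}` over the sublists `(i₁, a₁), …, (i_p, a_p)` of `L` for which
`a₁ ⋯ a_p` is a reduced word of `w`. -/
noncomputable def wordSum (L : List (ℕ × ℕ)) (w : SInf) : MvPolynomial ℕ ℤ :=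
  (L.sublists.map fun l =>
    if l.map Prod.snd ∈ w.reducedWords then (l.map fun p => X p.1).prod else 0).sum

/-- A sublist of `L ++ [p]` either omits `p` or ends in it; in the second case the last letter must
be a descent. -/
theorem wordSum_append (L : List (ℕ × ℕ)) (p : ℕ × ℕ) :
    wordSum (L ++ [p]) = nilFactor (nilOp (MvPolynomial ℕ ℤ)) p.2
      (X p.1 : MvPolynomial ℕ ℤ) (wordSum L) := by
  classical
  ext1 w
  rw [nilFactor_apply]
  simp only [wordSum, List.sublists_concat, List.map_append, List.sum_append, List.map_map]
  congr 1
  split_ifs with h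
  · rw [← List.sum_map_mul_left]
    congr 1
    apply List.map_congr_left
    intro l _
    simp only [Function.comp_apply, List.map_append, List.map_cons, List.map_nil,
      append_mem_reducedWords, h, true_and, List.prod_append, List.prod_singleton]
    split_ifs
    · ring
    · simp
  · rw [mul_zero]
    apply List.sum_eq_zero
    intro y hy
    rw [List.mem_map] at hy
    obtain ⟨l, -, rfl⟩ := hy
    simp only [Function.comp_apply, List.map_append, List.map_cons, List.map_nil,
      append_mem_reducedWords, h, false_and, if_false]

theorem wordSum_append_rowList (L : List (ℕ × ℕ)) (r i d : ℕ) :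
    wordSum (L ++ rowList r i d) =
      nilRow (nilOp (MvPolynomial ℕ ℤ)) i d (X r : MvPolynomial ℕ ℤ) (wordSum L) := by
  induction d generalizing i with
  | zero => simp [rowList, nilRow]
  | succ d ih => rw [rowList, ← List.append_assoc, wordSum_append, ih]; rfl

theorem wordSum_gridList (n k : ℕ) :
    wordSum (gridList n k) = nilRows n (X : ℕ → MvPolynomial ℕ ℤ) k (wordSum []) := by
  induction k with
  | zero => rfl
  | succ k ih => rw [gridList, wordSum_append_rowList, ih]; rfl

theorem isChain_ne_of_mem_reducedWords {w : SInf} {l : List ℕ} (hl : l ∈ w.reducedWords) :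
    l.IsChain (· ≠ ·) := by
  induction l using List.reverseRecOn generalizing w with
  | nil => exact List.isChain_nil
  | append_singleton l a ih =>
    rw [append_mem_reducedWords] at hl
    rw [List.isChain_append]
    refine ⟨ih hl.2, List.isChain_singleton _, ?_⟩
    rintro x hx y hy rfl
    simp only [List.head?_cons, Option.mem_def, Option.some.injEq] at hy
    subst hy
    obtain ⟨l', rfl⟩ := List.getLast?_eq_some_iff.1 hx
    rw [append_mem_reducedWords, mulSwap_left, mulSwap_right] at hl
    omega

/-- Neighbouring letters of a reduced word differ, so the compatibility conditions say precisely
that the pairs `(i_t, a_t)` follow each other in the order `pairLT`, within the grid. -/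
theorem zip_sublist_gridList {n : ℕ} {w : SInf} (hw : w.Fixes n) {a b : List ℕ}
    (ha : a ∈ w.reducedWords) (hb : b ∈ compatible a) : (b.zip a).Sublist (gridList n n) := by
  obtain ⟨hlen, h1, h2, h3⟩ := hb
  have hne := List.isChain_iff_getElem.1 (isChain_ne_of_mem_reducedWords ha)
  rw [sublist_gridList]
  constructor
  · rw [← List.isChain_iff_pairwise, List.isChain_iff_getElem]
    intro t ht
    have ht' : t + 1 < a.length := by
      rw [List.length_zip] at ht
      omega
    have e1 := h1 t ht'
    have e3 := h3 t ht'
    have e4 := hne t ht'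
    rw [List.getD_eq_getElem _ _ (by omega), List.getD_eq_getElem _ _ (by omega)] at e1 e3
    rw [List.getD_eq_getElem _ _ (by omega), List.getD_eq_getElem _ _ (by omega)] at e3
    simp only [List.getElem_zip, pairLT]
    omega
  · rintro ⟨i, c⟩ hp
    obtain ⟨t, ht, e⟩ := List.getElem_of_mem hp
    rw [List.length_zip] at ht
    rw [List.getElem_zip, Prod.mk.injEq] at e
    have e2 := h2 t (by omega)
    rw [List.getD_eq_getElem _ _ (by omega), List.getD_eq_getElem _ _ (by omega), e.1, e.2] at e2
    have e5 := hw.reducedWords_lt ha c (e.2 ▸ List.getElem_mem _)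
    simp only
    omega

theorem map_fst_mem_compatible {n : ℕ} {l : List (ℕ × ℕ)} (hl : l.Sublist (gridList n n)) :
    l.map Prod.fst ∈ compatible (l.map Prod.snd) := by
  rw [sublist_gridList, ← List.isChain_iff_pairwise, List.isChain_iff_getElem] at hl
  obtain ⟨h1, h2⟩ := hl
  refine ⟨by simp, fun t ht => ?_, fun t ht => ?_, fun t ht => ?_⟩
  all_goals rw [List.length_map] at ht
  · have := h1 t ht
    rw [List.getD_eq_getElem _ _ (by simp; omega), List.getD_eq_getElem _ _ (by simp; omega),
      List.getElem_map, List.getElem_map]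
    unfold pairLT at this
    omega
  · rw [List.getD_eq_getElem _ _ (by simp; omega), List.getD_eq_getElem _ _ (by simp; omega),
      List.getElem_map, List.getElem_map]
    exact (h2 _ (List.getElem_mem _)).2.1
  · have := h1 t ht
    rw [List.getD_eq_getElem _ _ (by simp; omega), List.getD_eq_getElem _ _ (by simp; omega),
      List.getD_eq_getElem _ _ (by simp; omega), List.getD_eq_getElem _ _ (by simp; omega),
      List.getElem_map, List.getElem_map, List.getElem_map, List.getElem_map]
    unfold pairLT at this
    omega

theorem schubert_eq_wordSum {n : ℕ} {w : SInf} (hw : w.Fixes n) :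
    w.schubert = wordSum (gridList n n) w := by
  classical
  set Q : Finset (List (ℕ × ℕ)) :=
    (gridList n n).sublists.toFinset.filter fun l => l.map Prod.snd ∈ w.reducedWords with hQ
  have hmem : ∀ l, l ∈ Q ↔ l.Sublist (gridList n n) ∧ l.map Prod.snd ∈ w.reducedWords := fun l => by
    rw [hQ, Finset.mem_filter, List.mem_toFinset, List.mem_sublists]
  have hsum : wordSum (gridList n n) w = ∑ l ∈ Q, (l.map fun p => X p.1).prod := by
    rw [wordSum, ← List.sum_toFinset _
      (List.nodup_sublists.2 (nodup_of_pairwise (pairwise_gridList n n))), hQ, Finset.sum_filter]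
  have hzip : ∀ l : List (ℕ × ℕ), (l.map Prod.fst).zip (l.map Prod.snd) = l := fun l => by
    induction l with
    | nil => rfl
    | cons p l ih => rw [List.map_cons, List.map_cons, List.zip_cons_cons, ih]
  rw [hsum, schubert, finsum_eq_sum_of_support_subset (s := Q.image fun l => l.map Prod.snd),
    ← Finset.sum_fiberwise_of_maps_to (s := Q) (g := fun l => l.map Prod.snd)
      (fun l hl => Finset.mem_image_of_mem _ hl)]
  · apply Finset.sum_congr rfl
    intro a ha
    obtain ⟨l₀, hl₀, rfl⟩ := Finset.mem_image.1 ha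
    have ha' := ((hmem _).1 hl₀).2
    rw [finsum_eq_if, if_pos ha']
    set a := l₀.map Prod.snd
    rw [finsum_eq_sum_of_support_subset
      (s := (Q.filter fun l => l.map Prod.snd = a).image fun l => l.map Prod.fst),
      Finset.sum_image]
    · apply Finset.sum_congr rfl
      intro l hl
      obtain ⟨h1, h2⟩ := Finset.mem_filter.1 hl
      rw [finsum_eq_if, if_pos, List.map_map]
      · rfl
      · rw [← h2]
        exact map_fst_mem_compatible ((hmem _).1 h1).1
    · intro l hl l' hl' e
      rw [Finset.mem_coe, Finset.mem_filter] at hl hl'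
      simp only at e
      rw [← hzip l, ← hzip l', hl.2, hl'.2, e]
    · intro b hb
      rw [Function.mem_support, finsum_eq_if] at hb
      have hb' : b ∈ compatible a := by
        by_contra h
        exact hb (if_neg h)
      have hlen := hb'.1
      rw [Finset.mem_coe, Finset.mem_image]
      refine ⟨b.zip a, Finset.mem_filter.2 ⟨(hmem _).2 ⟨zip_sublist_gridList hw ha' hb', ?_⟩, ?_⟩, ?_⟩
      · rwa [List.map_snd_zip hlen.ge]
      · exact List.map_snd_zip hlen.ge
      · exact List.map_fst_zip hlen.le
  · intro a ha
    rw [Function.mem_support, finsum_eq_if] at ha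
    have ha' : a ∈ w.reducedWords := by
      by_contra h
      exact ha (if_neg h)
    rw [if_pos ha'] at ha
    obtain ⟨b, hb⟩ : ∃ b, b ∈ compatible a := by
      by_contra! h
      apply ha
      rw [← finsum_zero (α := List ℕ)]
      congr 1
      ext1 b
      rw [finsum_eq_if, if_neg (h b)]
    rw [Finset.mem_coe, Finset.mem_image]
    refine ⟨b.zip a, (hmem _).2 ⟨zip_sublist_gridList hw ha' hb, ?_⟩, ?_⟩
    · rwa [List.map_snd_zip hb.1.ge]
    · exact List.map_snd_zip hb.1.ge

theorem gridList_add (n d : ℕ) : gridList n (n + d) = gridList n n := by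
  induction d with
  | zero => rfl
  | succ d ih =>
    rw [← add_assoc, gridList, ih, Nat.sub_eq_zero_of_le (by omega)]
    simp [rowList]

theorem schubert_eq_nilRows {n : ℕ} {w : SInf} (hw : w.Fixes n) :
    w.schubert = nilRows n (X : ℕ → MvPolynomial ℕ ℤ) (n + 2) (wordSum []) w := by
  rw [schubert_eq_wordSum hw, ← gridList_add n 2, wordSum_gridList]

/-! ### Divided differences, degree and positivity of Schubert polynomials. -/

/-- The action of the adjacent transposition `s_a` on polynomials. -/
noncomputable def swapVar (a : ℕ) : MvPolynomial ℕ ℤ →ₐ[ℤ] MvPolynomial ℕ ℤ :=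
  rename (Equiv.swap a (a + 1))

theorem swapVar_X (a k : ℕ) : swapVar a (X k) = X (Equiv.swap a (a + 1) k) := rename_X _ _

/-- Divided differences of Schubert polynomials. -/
theorem schubert_sub_swapVar (w : SInf) (a : ℕ) :
    w.schubert - swapVar a w.schubert = (X a - X (a + 1)) *
      if w.1 (a + 1) < w.1 a then (w.mulSwap a (a + 1)).schubert else 0 := by
  obtain ⟨N, hN⟩ := w.2
  have hw : w.Fixes (max N (a + 2)) := fun p hp => hN p (by omega)
  have hw' : (w.mulSwap a (a + 1)).Fixes (max N (a + 2)) := hw.mulSwap (by omega) (by omega)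
  have he : (swapVar a : MvPolynomial ℕ ℤ →+* MvPolynomial ℕ ℤ) ∘ wordSum [] = wordSum [] := by
    ext1 v
    simp only [wordSum, Function.comp_apply, List.sublists_nil, List.map_cons, List.map_nil,
      List.prod_nil, List.sum_singleton]
    split_ifs <;> simp
  have key := congrFun (nilRows_sub (max N (a + 2)) (X : ℕ → MvPolynomial ℕ ℤ)
    (swapVar a : MvPolynomial ℕ ℤ →+* MvPolynomial ℕ ℤ) (wordSum []) he a
    (by simp [swapVar_X]) (by simp [swapVar_X])
    (fun k h1 h2 => by simp [swapVar_X, Equiv.swap_apply_of_ne_of_ne h1 h2])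
    (max N (a + 2) + 2) (by omega) (by omega)) w
  rw [schubert_eq_nilRows hw, schubert_eq_nilRows hw']
  exact key

theorem isHomogeneous_schubert (w : SInf) : w.schubert.IsHomogeneous w.length := by
  obtain ⟨N, hN⟩ := w.2
  rw [schubert_eq_wordSum (show w.Fixes N from hN), wordSum]
  apply list_sum_mem (S := homogeneousSubmodule ℕ ℤ w.length)
  intro f hf
  obtain ⟨l, -, rfl⟩ := List.mem_map.1 hf
  split_ifs with h
  · have hlen : l.length = w.length := by rw [← h.2, List.length_map]
    rw [mem_homogeneousSubmodule, ← hlen]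
    clear hlen h hf
    induction l with
    | nil => exact isHomogeneous_one ℕ ℤ
    | cons p l ih =>
      rw [List.map_cons, List.prod_cons, List.length_cons, add_comm]
      exact (isHomogeneous_X ℤ p.1).mul ih
  · exact Submodule.zero_mem _

theorem coeff_schubert_nonneg (w : SInf) (d : ℕ →₀ ℕ) : 0 ≤ coeff d w.schubert := by
  obtain ⟨N, hN⟩ := w.2
  rw [schubert_eq_wordSum (show w.Fixes N from hN), wordSum]
  have : coeff d = (lcoeff ℤ d : MvPolynomial ℕ ℤ →ₗ[ℤ] ℤ) := rfl
  rw [this, map_list_sum, List.map_map]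
  apply List.sum_nonneg
  intro c hc
  obtain ⟨l, -, rfl⟩ := List.mem_map.1 hc
  simp only [Function.comp_apply, lcoeff_apply]
  split_ifs with hl
  · clear hl
    have h : (l.map fun p => (X p.1 : MvPolynomial ℕ ℤ)).prod =
        monomial (l.map fun p => Finsupp.single p.1 1).sum 1 := by
      clear hc
      induction l with
      | nil => rfl
      | cons p l ih =>
        rw [List.map_cons, List.prod_cons, ih, List.map_cons, List.sum_cons, X, monomial_mul,
          one_mul]
    rw [h, coeff_monomial]
    split_ifs <;> simp
  · simp

theorem schubert_id : id.schubert = 1 := by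
  have h : id.Fixes 0 := fun _ _ => rfl
  rw [schubert_eq_wordSum h]
  simp [wordSum, gridList, nil_mem_reducedWords]

/-! ### Covers under conjugation and two-step chains of covers. -/

theorem mulSwap_conj (w : SInf) (a p q : ℕ) :
    (w.mulSwap p q).mulSwap a (a + 1) = (w.mulSwap a (a + 1)).mulSwap
      (Equiv.swap a (a + 1) p) (Equiv.swap a (a + 1) q) := by
  apply Subtype.ext
  change w.1 * Equiv.swap p q * Equiv.swap a (a + 1) = w.1 * Equiv.swap a (a + 1) * Equiv.swap _ _
  rw [Equiv.swap_apply_apply]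
  simp [mul_assoc]

theorem Cov.ascent {w : SInf} {p q a : ℕ} (h : w.Cov p q) (ha : w.1 a < w.1 (a + 1))
    (hne : ¬ (p = a ∧ q = a + 1)) :
    (w.mulSwap p q).1 a < (w.mulSwap p q).1 (a + 1) := by
  obtain ⟨h1, h2, h3⟩ := h
  have e1 := h3 a
  have e2 := h3 (a + 1)
  simp only [mulSwap_ite]
  split_ifs <;> subst_vars <;> omega

/-- Outside the pair `(a, a + 1)`, this matches the terms of Monk's sum for `w` that survive `∂_a`
with the terms of the sum for `w s_a`. -/
theorem cov_conj {w : SInf} {p q a : ℕ} (ha : w.1 (a + 1) < w.1 a) (hne : ¬ (p = a ∧ q = a + 1))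
    (hpq : p < q) :
    (w.Cov p q ∧ (w.mulSwap p q).1 (a + 1) < (w.mulSwap p q).1 a) ↔
      (w.mulSwap a (a + 1)).Cov (Equiv.swap a (a + 1) p) (Equiv.swap a (a + 1) q) := by
  have key : (w.mulSwap a (a + 1)).Cov (Equiv.swap a (a + 1) p) (Equiv.swap a (a + 1) q) ↔
      w.1 p < w.1 q ∧ ∀ x, Equiv.swap a (a + 1) p < Equiv.swap a (a + 1) x →
        Equiv.swap a (a + 1) x < Equiv.swap a (a + 1) q → w.1 x < w.1 p ∨ w.1 q < w.1 x := by
    unfold Cov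
    simp only [mulSwap_apply, Equiv.swap_apply_self]
    constructor
    · rintro ⟨-, h2, h3⟩
      refine ⟨h2, fun x hx hx' => ?_⟩
      have := h3 _ hx hx'
      rwa [Equiv.swap_apply_self] at this
    · rintro ⟨h2, h3⟩
      refine ⟨?_, h2, fun x hx hx' => h3 _ ?_ ?_⟩
      · simp only [Equiv.swap_apply_def]
        split_ifs <;> omega
      · rwa [Equiv.swap_apply_self]
      · rwa [Equiv.swap_apply_self]
  rw [key]
  unfold Cov
  simp only [mulSwap_ite]
  constructor
  · rintro ⟨⟨h1, h2, h3⟩, h4⟩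
    refine ⟨h2, fun x hx hx' => ?_⟩
    have e1 := h3 x
    simp only [Equiv.swap_apply_def] at hx hx'
    split_ifs at hx hx' h4 <;> subst_vars <;> omega
  · rintro ⟨h2, h3⟩
    have e1 := h3 a
    have e2 := h3 (a + 1)
    refine ⟨⟨hpq, h2, fun x hx hx' => ?_⟩, ?_⟩
    · have e3 := h3 x
      simp only [Equiv.swap_apply_def] at e3
      split_ifs at e3 <;> subst_vars <;> omega
    · simp only [Equiv.swap_apply_def] at e1 e2
      split_ifs at e1 e2 ⊢ <;> subst_vars <;> omega

theorem cov_comm {w : SInf} {a b c d : ℕ} (h1 : a ≠ c) (h2 : a ≠ d) (h3 : b ≠ c) (h4 : b ≠ d)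
    (h : w.Cov a b) (h' : (w.mulSwap a b).Cov c d) : w.Cov c d ∧ (w.mulSwap c d).Cov a b := by
  obtain ⟨e1, e2, e3⟩ := h
  obtain ⟨f1, f2, f3⟩ := h'
  have a1 := f3 a
  have a2 := f3 b
  have a3 := e3 c
  have a4 := e3 d
  have i1 := w.apply_ne h1
  have i2 := w.apply_ne h2
  have i3 := w.apply_ne h3
  have i4 := w.apply_ne h4
  simp only [mulSwap_ite] at f2 f3 a1 a2
  simp only [h1.symm, h2.symm, h3.symm, h4.symm, if_false, if_true] at f2 f3 a1 a2
  constructor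
  · refine ⟨f1, f2, fun x hx hx' => ?_⟩
    have := f3 x hx hx'
    grind
  · refine ⟨e1, ?_, fun x hx hx' => ?_⟩
    · simp only [mulSwap_ite]; grind
    · have := e3 x hx hx'
      simp only [mulSwap_ite]; grind

/-- The same 3-cycle is `t_{mb} t_{am} = t_{am} t_{ab} = t_{ab} t_{mb}`. The order of `w a` and `w
m` decides which of the other two factorizations is a chain of covers exactly when the first one is;
the next lemma treats the opposite order. -/
theorem cov_triple_lt {w : SInf} {a m b : ℕ} (h1 : a < m) (h2 : m < b) (h : w.1 a < w.1 m) :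
    (w.Cov m b ∧ (w.mulSwap m b).Cov a m) ↔ (w.Cov a m ∧ (w.mulSwap a m).Cov a b) := by
  unfold Cov
  simp only [mulSwap_ite]
  constructor
  · rintro ⟨⟨e1, e2, e3⟩, f1, f2, f3⟩
    refine ⟨⟨h1, h, fun x hx hx' => ?_⟩, by omega, by grind, fun x hx hx' => ?_⟩
    · have := f3 x hx hx'; grind
    · have := e3 x; have := f3 x;  grind
  · rintro ⟨⟨e1, e2, e3⟩, f1, f2, f3⟩
    refine ⟨⟨h2, by grind, fun x hx hx' => ?_⟩, h1, by grind, fun x hx hx' => ?_⟩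
    · have := f3 x; grind
    · have := e3 x; have := f3 x; grind

theorem cov_triple_gt {w : SInf} {a m b : ℕ} (h1 : a < m) (h2 : m < b) (h : w.1 m < w.1 a) :
    (w.Cov m b ∧ (w.mulSwap m b).Cov a m) ↔ (w.Cov a b ∧ (w.mulSwap a b).Cov m b) := by
  unfold Cov
  simp only [mulSwap_ite]
  constructor
  · rintro ⟨⟨e1, e2, e3⟩, f1, f2, f3⟩
    refine ⟨⟨by omega, by grind, fun x hx hx' => ?_⟩, h2, by grind, fun x hx hx' => ?_⟩
    · have := f3 x; have := e3 x; grind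
    · have := e3 x; grind
  · rintro ⟨⟨e1, e2, e3⟩, f1, f2, f3⟩
    refine ⟨⟨h2, by grind, fun x hx hx' => ?_⟩, h1, by grind, fun x hx hx' => ?_⟩
    · have := f3 x; have := e3 x; grind
    · have := e3 x; grind
-- Schubert polynomials are linearly independent.
/-- The linear combination of Schubert polynomials with given coefficients. -/
noncomputable def expand : (SInf →₀ ℤ) →ₗ[ℤ] MvPolynomial ℕ ℤ :=
  Finsupp.linearCombination ℤ schubert

theorem expand_single (w : SInf) (r : ℤ) : expand (Finsupp.single w r) = r • w.schubert :=
  Finsupp.linearCombination_single ℤ r w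

theorem isSchubertExpansion_iff (f : MvPolynomial ℕ ℤ) (c : SInf →₀ ℤ) :
    IsSchubertExpansion f c ↔ f = expand c := by
  unfold IsSchubertExpansion expand
  rw [Finsupp.linearCombination_apply, Finsupp.sum]
  simp only [smul_eq_C_mul]

theorem constantCoeff_schubert {w : SInf} (hw : w ≠ id) : constantCoeff w.schubert = 0 := by
  obtain ⟨a, ha⟩ := w.exists_descent hw
  have h := length_mulSwap_of_gt w ha
  exact w.isHomogeneous_schubert.coeff_eq_zero (d := 0) (by simp; omega)

theorem X_sub_ne_zero (a : ℕ) : (X a - X (a + 1) : MvPolynomial ℕ ℤ) ≠ 0 := by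
  rw [sub_ne_zero]
  exact fun h => by simpa using X_injective h

/-- A polynomial invariant under all adjacent transpositions of the infinitely many variables is
constant. -/
theorem eq_C_of_swapVar {f : MvPolynomial ℕ ℤ} (h : ∀ a, swapVar a f = f) :
    f = C (constantCoeff f) := by
  classical
  have hstep : ∀ k, k ∈ f.vars → k + 1 ∈ f.vars := by
    intro k hk
    have hsub : f.vars ⊆ f.vars.image (Equiv.swap k (k + 1)) := by
      conv_lhs => rw [← h k]
      exact vars_rename _ f
    obtain ⟨x, hx, e⟩ := Finset.mem_image.1 (hsub hk)
    have hxk : x = k + 1 := by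
      rw [← Equiv.swap_apply_self k (k + 1) x, e, Equiv.swap_apply_left]
    exact hxk ▸ hx
  have hvars : f.vars = ∅ := by
    by_contra hne
    obtain ⟨k, hk⟩ := Finset.nonempty_iff_ne_empty.2 hne
    have hall : ∀ d, k + d ∈ f.vars := by
      intro d
      induction d with
      | zero => exact hk
      | succ d ih => exact hstep _ ih
    have := f.vars.le_max' _ (hall (f.vars.max' ⟨k, hk⟩ + 1))
    omega
  exact vars_eq_empty_iff_eq_C.1 hvars

theorem eq_zero_of_swapVar {f : MvPolynomial ℕ ℤ} (h : ∀ a, swapVar a f = f)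
    (h0 : constantCoeff f = 0) : f = 0 := by
  rw [eq_C_of_swapVar h, h0, C_0]

open Classical in
/-- The divided difference operator `∂_a` in terms of expansions into Schubert polynomials. -/
noncomputable def descend (a : ℕ) : (SInf →₀ ℤ) →ₗ[ℤ] (SInf →₀ ℤ) :=
  Finsupp.linearCombination ℤ fun w =>
    if w.1 (a + 1) < w.1 a then Finsupp.single (w.mulSwap a (a + 1)) 1 else 0

theorem descend_single (a : ℕ) (w : SInf) (r : ℤ) :
    descend a (Finsupp.single w r) =
      if w.1 (a + 1) < w.1 a then Finsupp.single (w.mulSwap a (a + 1)) r else 0 := by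
  rw [descend, Finsupp.linearCombination_single]
  split_ifs <;> simp

theorem descend_apply (a : ℕ) (c : SInf →₀ ℤ) (v : SInf) :
    descend a c v = if v.1 a < v.1 (a + 1) then c (v.mulSwap a (a + 1)) else 0 := by
  classical
  induction c using Finsupp.induction_linear with
  | zero => simp
  | add c d hc hd =>
    rw [map_add, Finsupp.add_apply, hc, hd]
    split_ifs <;> simp
  | single w r =>
    rw [descend_single]
    by_cases hvw : v = w.mulSwap a (a + 1)
    · subst hvw
      rw [mulSwap_left, mulSwap_right, mulSwap_mulSwap]
      split_ifs <;> simp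
    · have h1 : v.mulSwap a (a + 1) ≠ w := fun e => hvw (by rw [← e, mulSwap_mulSwap])
      split_ifs <;> simp [Ne.symm hvw, Ne.symm h1]

theorem expand_sub_swapVar (a : ℕ) (c : SInf →₀ ℤ) :
    expand c - swapVar a (expand c) = (X a - X (a + 1)) * expand (descend a c) := by
  induction c using Finsupp.induction_linear with
  | zero => simp
  | add c d hc hd =>
    rw [map_add, map_add, map_add, map_add, mul_add, ← hc, ← hd]
    ring
  | single w r =>
    rw [expand_single, map_smul, ← smul_sub, schubert_sub_swapVar, descend_single]
    split_ifs
    · rw [expand_single, mul_smul_comm]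
    · simp

theorem constantCoeff_expand (c : SInf →₀ ℤ) : constantCoeff (expand c) = c id := by
  classical
  induction c using Finsupp.induction_linear with
  | zero => simp
  | add c d hc hd => rw [map_add, map_add, hc, hd, Finsupp.add_apply]
  | single w r =>
    rw [expand_single, smul_eq_C_mul, map_mul, constantCoeff_C]
    by_cases hw : w = id
    · subst hw
      simp [schubert_id]
    · rw [constantCoeff_schubert hw, Finsupp.single_apply, if_neg hw, mul_zero]

theorem expand_descend_of_sub {a : ℕ} {c : SInf →₀ ℤ} {g : MvPolynomial ℕ ℤ}
    (h : expand c - swapVar a (expand c) = (X a - X (a + 1)) * g) : expand (descend a c) = g := by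
  rw [expand_sub_swapVar] at h
  exact mul_left_cancel₀ (X_sub_ne_zero a) h

/-- Divided differences along descents of `v` move the coefficient at `v` to the coefficient at the
identity, which is the constant term. -/
theorem expand_injective : Function.Injective expand := by
  rw [← LinearMap.ker_eq_bot, LinearMap.ker_eq_bot']
  suffices ∀ (v : SInf) (c : SInf →₀ ℤ), expand c = 0 → c v = 0 from
    fun c hc => Finsupp.ext fun v => this v c hc
  intro v
  induction v using induction_descent with
  | _ v ih =>
    intro c hc
    by_cases hv : v = id
    · rw [hv, ← constantCoeff_expand, hc, map_zero]
    · obtain ⟨a, ha⟩ := v.exists_descent hv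
      have h := ih a ha (descend a c) (expand_descend_of_sub (by rw [hc]; simp))
      rw [descend_apply, mulSwap_left, mulSwap_right, if_pos ha, mulSwap_mulSwap] at h
      exact h

/-! ### Monk's rule and the spanning property. -/

open Classical in
/-- The basis element of `w t_{ab}` if it covers `w`, and `0` otherwise. -/
noncomputable def cover (w : SInf) (a b : ℕ) : SInf →₀ ℤ :=
  if w.Cov a b then Finsupp.single (w.mulSwap a b) 1 else 0

theorem cover_pos {w : SInf} {a b : ℕ} (h : w.Cov a b) :
    w.cover a b = Finsupp.single (w.mulSwap a b) 1 := if_pos h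

theorem cover_neg {w : SInf} {a b : ℕ} (h : ¬ w.Cov a b) : w.cover a b = 0 := if_neg h

/-- The antisymmetric version of `cover`. -/
noncomputable def signedCover (w : SInf) (a b : ℕ) : SInf →₀ ℤ :=
  w.cover a b - w.cover b a

theorem cover_of_le (w : SInf) {a b : ℕ} (h : b ≤ a) : w.cover a b = 0 :=
  cover_neg fun h' => by
    have := h'.1
    omega

theorem descend_cover_of_ascent {w : SInf} {a p q : ℕ} (ha : w.1 a < w.1 (a + 1)) :
    descend a (w.cover p q) = if p = a ∧ q = a + 1 then Finsupp.single w 1 else 0 := by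
  split_ifs with h
  · obtain ⟨rfl, rfl⟩ := h
    rw [cover_pos ⟨by omega, ha, fun x _ _ => by omega⟩, descend_single, if_pos, mulSwap_mulSwap]
    rwa [mulSwap_left, mulSwap_right]
  · by_cases hc : w.Cov p q
    · rw [cover_pos hc, descend_single, if_neg]
      have := hc.ascent ha h
      omega
    · rw [cover_neg hc, map_zero]

theorem descend_cover_of_descent {w : SInf} {a p q : ℕ} (ha : w.1 (a + 1) < w.1 a) (hpq : p < q)
    (hne : ¬ (p = a ∧ q = a + 1)) :
    descend a (w.cover p q) = (w.mulSwap a (a + 1)).cover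
      (Equiv.swap a (a + 1) p) (Equiv.swap a (a + 1) q) := by
  by_cases h : w.Cov p q ∧ (w.mulSwap p q).1 (a + 1) < (w.mulSwap p q).1 a
  · rw [cover_pos h.1, descend_single, if_pos h.2, cover_pos ((cov_conj ha hne hpq).1 h),
      mulSwap_conj]
  · rw [cover_neg fun h' => h ((cov_conj ha hne hpq).2 h')]
    by_cases hc : w.Cov p q
    · rw [cover_pos hc, descend_single, if_neg fun h' => h ⟨hc, h'⟩]
    · rw [cover_neg hc, map_zero]

/-- The correction occurs only when `{k, b} = {a, a + 1}`. Summed over `b`, it becomes the Leibniz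
term `(∂_a x_k) 𝔖_w`. -/
theorem descend_signedCover {w : SInf} {a k b : ℕ} :
    descend a (w.signedCover k b) =
      (if w.1 (a + 1) < w.1 a then (w.mulSwap a (a + 1)).signedCover
        (Equiv.swap a (a + 1) k) (Equiv.swap a (a + 1) b) else 0) +
      ((if k = a ∧ b = a + 1 then Finsupp.single w 1 else 0) -
        (if b = a ∧ k = a + 1 then Finsupp.single w 1 else 0)) := by
  rw [signedCover, map_sub]
  rcases w.ascent_or_descent a with h | h
  · rw [if_neg (by omega), descend_cover_of_ascent h, descend_cover_of_ascent h, zero_add]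
  · rw [if_pos h]
    have hs : ∀ {p q}, p < q → ¬ (p = a ∧ q = a + 1) →
        Equiv.swap a (a + 1) p < Equiv.swap a (a + 1) q := by
      intro p q h1 h2
      simp only [Equiv.swap_apply_def]
      split_ifs <;> omega
    have h0 : w.cover a (a + 1) = 0 := cover_neg fun h' => by
      have := h'.2.1
      omega
    have h1 : (w.mulSwap a (a + 1)).cover a (a + 1) = Finsupp.single w 1 := by
      rw [cover_pos, mulSwap_mulSwap]
      exact ⟨by omega, by rwa [mulSwap_left, mulSwap_right], fun x _ _ => by omega⟩
    by_cases e1 : k = a ∧ b = a + 1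
    · obtain ⟨rfl, rfl⟩ := e1
      rw [h0, cover_of_le _ (by omega), Equiv.swap_apply_left, Equiv.swap_apply_right, signedCover,
        h1, cover_of_le _ (by omega), if_pos ⟨rfl, rfl⟩, if_neg (by omega)]
      simp
    by_cases e2 : b = a ∧ k = a + 1
    · obtain ⟨rfl, rfl⟩ := e2
      rw [h0, cover_of_le _ (by omega), Equiv.swap_apply_left, Equiv.swap_apply_right, signedCover,
        h1, cover_of_le _ (by omega), if_neg (by omega), if_pos ⟨rfl, rfl⟩]
      simp
    rw [if_neg e1, if_neg e2, sub_zero, add_zero, signedCover]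
    rcases lt_trichotomy k b with hkb | hkb | hkb
    · rw [descend_cover_of_descent h hkb e1, cover_of_le _ hkb.le, cover_of_le _ (hs hkb e1).le,
        map_zero]
    · subst hkb
      simp
    · rw [descend_cover_of_descent h hkb e2, cover_of_le _ hkb.le, cover_of_le _ (hs hkb e2).le,
        map_zero]

/-- The expansion of `x_k 𝔖_w`, where only positions smaller than `B` are considered. -/
noncomputable def monk (B k : ℕ) (w : SInf) : SInf →₀ ℤ := ∑ b ∈ Finset.range B, w.signedCover k b

theorem descend_monk {B N k a : ℕ} {w : SInf} (hw : w.Fixes N) (hB : N < B) (hk : k + 1 < B) :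
    descend a (monk B k w) =
      (if w.1 (a + 1) < w.1 a then monk B (Equiv.swap a (a + 1) k) (w.mulSwap a (a + 1)) else 0) +
      ((if k = a then Finsupp.single w 1 else 0) -
        (if k = a + 1 then Finsupp.single w 1 else 0)) := by
  simp only [monk, map_sum, descend_signedCover, Finset.sum_add_distrib, Finset.sum_sub_distrib]
  congr 1
  · split_ifs with h
    · have ha := hw.descent_lt h
      -- A descent satisfies `a + 1 < N < B`, so `s_a` permutes the range of summation.
      refine Finset.sum_equiv (Equiv.swap a (a + 1)) (fun b => ?_) (fun _ _ => rfl)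
      simp only [Finset.mem_range, Equiv.swap_apply_def]
      split_ifs <;> omega
    · simp
  · congr 1
    · by_cases h : k = a
      · subst h
        simp [hk]
      · simp [h]
    · by_cases h : k = a + 1
      · subst h
        simp only [and_true, if_true, Finset.sum_ite_eq', Finset.mem_range]
        rw [if_pos (by omega)]
      · simp [h]

theorem cover_id (w : SInf) (a b : ℕ) : w.cover a b id = 0 := by
  classical
  by_cases h : w.Cov a b
  · rw [cover_pos h, Finsupp.single_apply, if_neg]
    intro e
    have h1 := mulSwap_left w a b
    have h2 := mulSwap_right w a b
    rw [e, id_apply] at h1 h2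
    have := h.1
    have := h.2.1
    omega
  · rw [cover_neg h, Finsupp.zero_apply]

theorem monk_id (B k : ℕ) (w : SInf) : monk B k w id = 0 := by
  rw [monk, Finsupp.finsetSum_apply]
  refine Finset.sum_eq_zero fun b _ => ?_
  rw [signedCover, Finsupp.sub_apply, cover_id, cover_id, sub_zero]

theorem X_sub_X_swap (a k : ℕ) : (X k - X (Equiv.swap a (a + 1) k) : MvPolynomial ℕ ℤ) =
    (X a - X (a + 1)) * ((if k = a then 1 else 0) - (if k = a + 1 then 1 else 0)) := by
  rw [Equiv.swap_apply_def]
  split_ifs <;> first | omega | (subst_vars; ring)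

/-- Monk's rule for the multiplication by a variable. -/
theorem X_mul_schubert {B N k : ℕ} {w : SInf} (hw : w.Fixes N) (hB : N < B) (hk : k + 1 < B) :
    X k * w.schubert = expand (monk B k w) := by
  induction w using induction_descent generalizing k with
  | _ w ih =>
    rw [← sub_eq_zero]
    -- By the Leibniz rule and induction both sides have the same divided differences, so their
    -- difference is symmetric in infinitely many variables, hence constant.
    apply eq_zero_of_swapVar
    · intro a
      have h1 := w.schubert_sub_swapVar a
      have h2 := expand_sub_swapVar a (monk B k w)
      have h3 := X_sub_X_swap a k
      have h4 : expand (descend a (monk B k w)) = X (Equiv.swap a (a + 1) k) *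
          (if w.1 (a + 1) < w.1 a then (w.mulSwap a (a + 1)).schubert else 0) +
          ((if k = a then 1 else 0) - (if k = a + 1 then 1 else 0)) * w.schubert := by
        rw [descend_monk hw hB hk, map_add]
        congr 1
        · split_ifs with h
          · have ha := hw.descent_lt h
            rw [ih a h (hw.mulSwap (by omega) ha)]
            simp only [Equiv.swap_apply_def]
            split_ifs <;> omega
          · simp
        · split_ifs <;> simp [expand_single]
      rw [h4] at h2
      rw [map_sub, map_mul, swapVar_X]
      linear_combination -h2 * (-1) - X (Equiv.swap a (a + 1) k) * h1 - w.schubert * h3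
    · rw [map_sub, map_mul, constantCoeff_X, zero_mul, constantCoeff_expand, monk_id, sub_zero]

theorem expand_surjective : Function.Surjective expand := by
  intro f
  induction f using MvPolynomial.induction_on with
  | C r => exact ⟨Finsupp.single id r, by rw [expand_single, schubert_id, smul_eq_C_mul, mul_one]⟩
  | add f g hf hg =>
    obtain ⟨c, rfl⟩ := hf
    obtain ⟨d, rfl⟩ := hg
    exact ⟨c + d, map_add _ _ _⟩
  | mul_X f k hf =>
    obtain ⟨c, rfl⟩ := hf
    induction c using Finsupp.induction_linear with
    | zero => exact ⟨0, by simp⟩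
    | add c d hc hd =>
      obtain ⟨c', hc'⟩ := hc
      obtain ⟨d', hd'⟩ := hd
      exact ⟨c' + d', by rw [map_add, map_add, hc', hd', add_mul]⟩
    | single w r =>
      obtain ⟨N, hN⟩ := w.2
      refine ⟨r • monk (N + k + 2) k w, ?_⟩
      rw [map_smul, ← X_mul_schubert (N := N) (show w.Fixes N from hN) (by omega) (by omega),
        expand_single, smul_mul_assoc, mul_comm]

/-! ### Pieri's rule from Monk's rule. -/

/-- The linear operator `w ↦ w.cover a b`. -/
noncomputable def coverOp (a b : ℕ) : Module.End ℤ (SInf →₀ ℤ) :=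
  Finsupp.linearCombination ℤ fun w => w.cover a b

theorem coverOp_single (a b : ℕ) (w : SInf) : coverOp a b (Finsupp.single w 1) = w.cover a b := by
  rw [coverOp, Finsupp.linearCombination_single, one_smul]

theorem mulSwap_comm (w : SInf) {a b c d : ℕ} (h1 : a ≠ c) (h2 : a ≠ d) (h3 : b ≠ c)
    (h4 : b ≠ d) : (w.mulSwap a b).mulSwap c d = (w.mulSwap c d).mulSwap a b := by
  apply ext_apply
  intro p
  simp only [mulSwap_ite]
  split_ifs <;> first | rfl | omega

theorem coverOp_cover (w : SInf) (a b c d : ℕ) [Decidable (w.Cov a b ∧ (w.mulSwap a b).Cov c d)] :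
    coverOp c d (w.cover a b) = if w.Cov a b ∧ (w.mulSwap a b).Cov c d then
      Finsupp.single ((w.mulSwap a b).mulSwap c d) 1 else 0 := by
  by_cases h : w.Cov a b
  · rw [cover_pos h, coverOp_single]
    by_cases h' : (w.mulSwap a b).Cov c d
    · rw [cover_pos h', if_pos ⟨h, h'⟩]
    · rw [cover_neg h', if_neg fun e => h' e.2]
  · rw [cover_neg h, map_zero, if_neg fun e => h e.1]

theorem coverOp_cover_comm (w : SInf) {a b c d : ℕ} (h1 : a ≠ c) (h2 : a ≠ d) (h3 : b ≠ c)
    (h4 : b ≠ d) : coverOp c d (w.cover a b) = coverOp a b (w.cover c d) := by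
  classical
  rw [coverOp_cover, coverOp_cover, mulSwap_comm w h1 h2 h3 h4]
  have : (w.Cov a b ∧ (w.mulSwap a b).Cov c d) ↔ (w.Cov c d ∧ (w.mulSwap c d).Cov a b) :=
    ⟨fun h => cov_comm h1 h2 h3 h4 h.1 h.2,
      fun h => cov_comm h1.symm h3.symm h2.symm h4.symm h.1 h.2⟩
  simp only [this]

theorem coverOp_triple_lt {w : SInf} {a m b : ℕ} (h1 : a < m) (h2 : m < b) (h : w.1 a < w.1 m) :
    coverOp a m (w.cover m b) = coverOp a b (w.cover a m) := by
  classical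
  rw [coverOp_cover, coverOp_cover]
  have e : (w.mulSwap m b).mulSwap a m = (w.mulSwap a m).mulSwap a b := by
    apply ext_apply
    intro p
    simp only [mulSwap_ite]
    split_ifs <;> first | rfl | omega
  simp only [cov_triple_lt h1 h2 h, e]

theorem coverOp_triple_gt {w : SInf} {a m b : ℕ} (h1 : a < m) (h2 : m < b) (h : w.1 m < w.1 a) :
    coverOp a m (w.cover m b) = coverOp m b (w.cover a b) := by
  classical
  rw [coverOp_cover, coverOp_cover]
  have e : (w.mulSwap m b).mulSwap a m = (w.mulSwap a b).mulSwap m b := by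
    apply ext_apply
    intro p
    simp only [mulSwap_ite]
    split_ifs <;> first | rfl | omega
  simp only [cov_triple_gt h1 h2 h, e]

/-- If the values at the positions `c`, `d` are in the wrong order after exchanging `a` and `b`,
then the composite of the covers vanishes. -/
theorem coverOp_cover_eq_zero {w : SInf} {a b c d : ℕ}
    (h : w.Cov a b → (w.mulSwap a b).1 d ≤ (w.mulSwap a b).1 c) :
    coverOp c d (w.cover a b) = 0 := by
  classical
  rw [coverOp_cover, if_neg]
  rintro ⟨h1, h2⟩
  have := h h1
  have := h2.2.1
  omega

/-- The sum of the covers of `w` that exchange the value `c`, at a position smaller than `m`, with a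
larger value at a position `b` with `m ≤ b < B`. -/
noncomputable def valueCovers (B m c : ℕ) (w : SInf) : SInf →₀ ℤ :=
  if w.1.symm c < m then ∑ b ∈ Finset.Ico m B, w.cover (w.1.symm c) b else 0

/-- The part of the expansion of `x_m 𝔖_w` that consists of the terms exchanging two values the
smaller of which is less than `c`. -/
noncomputable def monkBelow (B m c : ℕ) (w : SInf) : SInf →₀ ℤ :=
  (if w.1 m < c then ∑ b ∈ Finset.Ico (m + 1) B, w.cover m b else 0) -
    ∑ a ∈ Finset.range m, if w.1 a < c then w.cover a m else 0

/-- `valueCovers` as a linear operator. -/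
noncomputable def valueOp (B m c : ℕ) : Module.End ℤ (SInf →₀ ℤ) :=
  Finsupp.linearCombination ℤ (valueCovers B m c)

/-- `monkBelow` as a linear operator. -/
noncomputable def monkOp (B m c : ℕ) : Module.End ℤ (SInf →₀ ℤ) :=
  Finsupp.linearCombination ℤ (monkBelow B m c)

theorem valueOp_single (B m c : ℕ) (w : SInf) :
    valueOp B m c (Finsupp.single w 1) = valueCovers B m c w := by
  rw [valueOp, Finsupp.linearCombination_single, one_smul]

theorem monkOp_single (B m c : ℕ) (w : SInf) :
    monkOp B m c (Finsupp.single w 1) = monkBelow B m c w := by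
  rw [monkOp, Finsupp.linearCombination_single, one_smul]

theorem mulSwap_symm_apply (w : SInf) (x y c : ℕ) :
    (w.mulSwap x y).1.symm c = Equiv.swap x y (w.1.symm c) := by
  rw [Equiv.symm_apply_eq, mulSwap_apply, Equiv.swap_apply_self, Equiv.apply_symm_apply]

theorem valueOp_cover (B m c : ℕ) (w : SInf) (x y : ℕ) :
    valueOp B m c (w.cover x y) = if Equiv.swap x y (w.1.symm c) < m then
      ∑ b ∈ Finset.Ico m B, coverOp (Equiv.swap x y (w.1.symm c)) b (w.cover x y) else 0 := by
  by_cases h : w.Cov x y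
  · rw [cover_pos h, valueOp_single, valueCovers, mulSwap_symm_apply]
    simp only [coverOp_single]
  · rw [cover_neg h]
    simp

theorem monkOp_cover (B m c : ℕ) (w : SInf) (x y : ℕ) :
    monkOp B m c (w.cover x y) =
      (if (w.mulSwap x y).1 m < c then
        ∑ b ∈ Finset.Ico (m + 1) B, coverOp m b (w.cover x y) else 0) -
      ∑ a ∈ Finset.range m,
        if (w.mulSwap x y).1 a < c then coverOp a m (w.cover x y) else 0 := by
  by_cases h : w.Cov x y
  · rw [cover_pos h, monkOp_single, monkBelow]
    simp only [coverOp_single]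
  · rw [cover_neg h]
    simp

theorem sum_range_lt_succ (w : SInf) {m c : ℕ} (f : ℕ → SInf →₀ ℤ) :
    (∑ a ∈ Finset.range m, if w.1 a < c + 1 then f a else 0) =
      (∑ a ∈ Finset.range m, if w.1 a < c then f a else 0) +
        if w.1.symm c < m then f (w.1.symm c) else 0 := by
  have h : ∀ a, (if w.1 a < c + 1 then f a else 0) =
      (if w.1 a < c then f a else 0) + if a = w.1.symm c then f a else 0 := by
    intro a
    have : a = w.1.symm c ↔ w.1 a = c := Equiv.eq_symm_apply _
    simp only [this]
    split_ifs <;> first | omega | simp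
  simp only [h, Finset.sum_add_distrib, Finset.sum_ite_eq', Finset.mem_range]

/-- Linear part of the exchange relation: raising `c` to `c + 1` adds to `monkBelow` the terms whose
smaller value is `c`, and these are also the difference of `valueCovers` at `m + 1` and at `m`. -/
theorem monkBelow_add_valueCovers {B m c : ℕ} (hB : m < B) (w : SInf) :
    monkBelow B m c w + valueCovers B (m + 1) c w =
      monkBelow B m (c + 1) w + valueCovers B m c w := by
  have hp : w.1 (w.1.symm c) = c := Equiv.apply_symm_apply _ _
  have hpm : w.1.symm c = m ↔ w.1 m = c := by
    rw [Equiv.symm_apply_eq, eq_comm]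
  unfold monkBelow valueCovers
  rw [sum_range_lt_succ]
  rcases lt_trichotomy (w.1.symm c) m with h | h | h
  · have hne : w.1 m ≠ c := fun e => h.ne (hpm.2 e)
    have : w.1 m < c + 1 ↔ w.1 m < c := by omega
    rw [if_pos (show w.1.symm c < m + 1 by omega), if_pos h, if_pos h,
      Finset.sum_eq_sum_Ico_succ_bot hB (fun b => w.cover (w.1.symm c) b)]
    simp only [this]
    abel
  · have e := hpm.1 h
    rw [if_neg (show ¬ w.1 m < c by omega), if_pos (show w.1 m < c + 1 by omega),
      if_pos (show w.1.symm c < m + 1 by omega), if_neg (show ¬ w.1.symm c < m by omega),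
      if_neg (show ¬ w.1.symm c < m by omega), h]
    abel
  · have hne : w.1 m ≠ c := fun e => h.ne' (hpm.2 e)
    have : w.1 m < c + 1 ↔ w.1 m < c := by omega
    rw [if_neg (show ¬ w.1.symm c < m + 1 by omega), if_neg (show ¬ w.1.symm c < m by omega),
      if_neg (show ¬ w.1.symm c < m by omega)]
    simp only [this]
    abel

/-- Quadratic part of the exchange relation, in three cases according to the position of the value
`c` relative to `m`. Here exchanging `m` with a later position takes `c` out of reach of `valueOp`,
and the remaining chains agree by `coverOp_triple_lt`. -/
theorem monkOp_valueCovers_of_eq {B m c : ℕ} (hB : m < B) (w : SInf) (h : w.1.symm c = m) :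
    monkOp B m c (valueCovers B (m + 1) c w) = valueOp B m c (monkBelow B m (c + 1) w) := by
  have e : w.1 m = c := by rw [← h, Equiv.apply_symm_apply]
  rw [valueCovers, monkBelow, if_pos (by omega), if_pos (by omega), h, sum_range_lt_succ, h,
    if_neg (by omega), add_zero, map_sub, map_sum, map_sum, map_sum]
  have z : ∑ b ∈ Finset.Ico (m + 1) B, valueOp B m c (w.cover m b) = 0 := by
    refine Finset.sum_eq_zero fun b hb => ?_
    rw [Finset.mem_Ico] at hb
    rw [valueOp_cover, h, Equiv.swap_apply_left, if_neg (by omega)]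
  have hl : ∀ b ∈ Finset.Ico (m + 1) B, monkOp B m c (w.cover m b) =
      -∑ a ∈ Finset.range m, if w.1 a < c then coverOp a b (w.cover a m) else 0 := by
    intro b hb
    rw [Finset.mem_Ico] at hb
    by_cases hc : w.Cov m b
    · have hc2 := hc.2.1
      rw [monkOp_cover, mulSwap_left, if_neg (by omega), zero_sub, neg_inj]
      refine Finset.sum_congr rfl fun a ha => ?_
      rw [Finset.mem_range] at ha
      rw [mulSwap_of_ne _ (by omega) (by omega)]
      split_ifs with hac
      · exact coverOp_triple_lt ha (by omega) (by omega)
      · rfl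
    · rw [cover_neg hc, map_zero, eq_comm, neg_eq_zero]
      refine Finset.sum_eq_zero fun a ha => ?_
      rw [Finset.mem_range] at ha
      split_ifs with hac
      · rw [← coverOp_triple_lt ha (by omega) (by omega), cover_neg hc, map_zero]
      · rfl
  have hr : ∀ a ∈ Finset.range m, valueOp B m c (if w.1 a < c then w.cover a m else 0) =
      ∑ b ∈ Finset.Ico (m + 1) B, if w.1 a < c then coverOp a b (w.cover a m) else 0 := by
    intro a ha
    rw [Finset.mem_range] at ha
    split_ifs with hac
    · rw [valueOp_cover, h, Equiv.swap_apply_right, if_pos ha,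
        Finset.sum_eq_sum_Ico_succ_bot hB, coverOp_cover_eq_zero, zero_add]
      intro _
      rw [mulSwap_left, mulSwap_right]
      omega
    · simp
  rw [z, zero_sub, Finset.sum_congr rfl hl, Finset.sum_congr rfl hr, Finset.sum_neg_distrib,
    Finset.sum_comm]

theorem monkOp_valueCovers_of_lt {B m c : ℕ} (hB : m < B) (w : SInf) (h : w.1.symm c < m) :
    monkOp B m c (valueCovers B (m + 1) c w) = valueOp B m c (monkBelow B m (c + 1) w) := by
  obtain ⟨p, hp⟩ : ∃ p, w.1.symm c = p := ⟨_, rfl⟩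
  have e : w.1 p = c := by rw [← hp, Equiv.apply_symm_apply]
  have hpc : ∀ a, a ≠ p → w.1 a ≠ c := fun a ha => by
    rw [← e]
    exact w.apply_ne ha
  have hmc := hpc m (by omega)
  rw [valueCovers, monkBelow, if_pos (by omega), sum_range_lt_succ, if_pos h, hp, map_sub, map_sum,
    map_add]
  rw [hp] at h
  have hl : ∀ b ∈ Finset.Ico (m + 1) B, monkOp B m c (w.cover p b) =
      (if w.1 m < c then ∑ b' ∈ Finset.Ico (m + 1) B, coverOp m b' (w.cover p b) else 0) -
        ∑ a ∈ Finset.range m, if w.1 a < c then coverOp p b (w.cover a m) else 0 := by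
    intro b hb
    rw [Finset.mem_Ico] at hb
    rw [monkOp_cover, mulSwap_of_ne _ (by omega) (by omega)]
    congr 1
    refine Finset.sum_congr rfl fun a ha => ?_
    rw [Finset.mem_range] at ha
    by_cases hap : a = p
    · subst hap
      rw [if_neg (show ¬ w.1 a < c by omega)]
      by_cases hc : w.Cov a b
      · have := hc.2.1
        rw [mulSwap_left, if_neg (by omega)]
      · rw [cover_neg hc, map_zero, ite_self]
    · rw [mulSwap_of_ne _ hap (by omega),
        coverOp_cover_comm w (Ne.symm hap) (by omega) (by omega) (by omega)]
  have hr1 : valueOp B m c (if w.1 m < c + 1 then ∑ b ∈ Finset.Ico (m + 1) B, w.cover m b else 0) =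
      if w.1 m < c then
        ∑ b' ∈ Finset.Ico (m + 1) B, ∑ b ∈ Finset.Ico (m + 1) B, coverOp m b' (w.cover p b)
      else 0 := by
    by_cases hc : w.1 m < c
    · rw [if_pos (by omega), if_pos hc, map_sum]
      refine Finset.sum_congr rfl fun b' hb' => ?_
      have hb'' := Finset.mem_Ico.1 hb'
      have hz : coverOp p b' (w.cover m b') = 0 := by
        refine coverOp_cover_eq_zero fun _ => ?_
        rw [mulSwap_right, mulSwap_of_ne _ (by omega) (by omega)]
        omega
      -- For `b ≠ b'` the two covers commute. On the right the term `b = b'` vanishes, and the term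
      -- `b = m` takes its place by the three-position relation.
      rw [valueOp_cover, hp, Equiv.swap_apply_of_ne_of_ne (by omega) (by omega), if_pos h,
        Finset.sum_eq_sum_Ico_succ_bot hB, coverOp_triple_gt h (by omega) (by omega),
        ← Finset.add_sum_erase _ _ hb', ← Finset.add_sum_erase _ _ hb', hz, zero_add]
      congr 1
      refine Finset.sum_congr rfl fun b hb => ?_
      rw [Finset.mem_erase, Finset.mem_Ico] at hb
      exact coverOp_cover_comm w (by omega) (by omega) (by omega) (Ne.symm hb.1)
    · rw [if_neg (by omega), if_neg hc, map_zero]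
  have hr2 : valueOp B m c (w.cover p m) = 0 := by
    rw [valueOp_cover, hp, Equiv.swap_apply_left, if_neg (by omega)]
  have hr3 : ∀ a ∈ Finset.range m, valueOp B m c (if w.1 a < c then w.cover a m else 0) =
      ∑ b ∈ Finset.Ico (m + 1) B, if w.1 a < c then coverOp p b (w.cover a m) else 0 := by
    intro a ha
    rw [Finset.mem_range] at ha
    split_ifs with hac
    · have hap : p ≠ a := by
        rintro rfl
        omega
      rw [valueOp_cover, hp, Equiv.swap_apply_of_ne_of_ne hap (by omega), if_pos h,
        Finset.sum_eq_sum_Ico_succ_bot hB, coverOp_cover_eq_zero, zero_add]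
      intro _
      rw [mulSwap_right, mulSwap_of_ne _ hap (by omega)]
      omega
    · simp
  rw [hr1, hr2, add_zero, map_sum, Finset.sum_congr rfl hr3, Finset.sum_congr rfl hl,
    Finset.sum_sub_distrib, Finset.sum_comm (s := Finset.range m)]
  congr 1
  split_ifs
  · exact Finset.sum_comm
  · simp

theorem monkOp_valueCovers_of_gt {B m c : ℕ} (w : SInf) (h : m < w.1.symm c) :
    monkOp B m c (valueCovers B (m + 1) c w) = valueOp B m c (monkBelow B m (c + 1) w) := by
  rw [valueCovers, if_neg (by omega), map_zero, monkBelow, sum_range_lt_succ,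
    if_neg (show ¬ w.1.symm c < m by omega), add_zero, map_sub, map_sum]
  have h1 : ∀ b ∈ Finset.Ico (m + 1) B, valueOp B m c (w.cover m b) = 0 := by
    intro b hb
    rw [Finset.mem_Ico] at hb
    rw [valueOp_cover, if_neg]
    rw [Equiv.swap_apply_def]
    split_ifs <;> omega
  have h2 : ∀ a ∈ Finset.range m, valueOp B m c (if w.1 a < c then w.cover a m else 0) = 0 := by
    intro a ha
    rw [Finset.mem_range] at ha
    split_ifs
    · rw [valueOp_cover, Equiv.swap_apply_of_ne_of_ne (by omega) (by omega), if_neg (by omega)]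
    · simp
  rw [Finset.sum_eq_zero h2, sub_zero]
  split_ifs
  · rw [map_sum, Finset.sum_eq_zero h1]
  · simp

theorem one_add_monkOp_mul {B m c : ℕ} (hB : m < B) :
    (1 + monkOp B m c) * (1 + valueOp B (m + 1) c) =
      (1 + valueOp B m c) * (1 + monkOp B m (c + 1)) := by
  have h1 : monkOp B m c + valueOp B (m + 1) c = monkOp B m (c + 1) + valueOp B m c := by
    refine Finsupp.lhom_ext' fun w => LinearMap.ext_ring ?_
    simp only [LinearMap.comp_apply, Finsupp.lsingle_apply, LinearMap.add_apply, valueOp_single,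
      monkOp_single, monkBelow_add_valueCovers hB]
  have h2 : monkOp B m c * valueOp B (m + 1) c = valueOp B m c * monkOp B m (c + 1) := by
    refine Finsupp.lhom_ext' fun w => LinearMap.ext_ring ?_
    simp only [LinearMap.comp_apply, Finsupp.lsingle_apply, Module.End.mul_apply, valueOp_single,
      monkOp_single]
    rcases lt_trichotomy (w.1.symm c) m with h | h | h
    · exact monkOp_valueCovers_of_lt hB w h
    · exact monkOp_valueCovers_of_eq hB w h
    · exact monkOp_valueCovers_of_gt w h
  simp only [mul_add, add_mul, one_mul, mul_one, h2]
  rw [eq_sub_of_add_eq h1]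
  abel

/-- The product of the operators `1 + valueOp B m d` for `d < c`, larger values acting first. -/
noncomputable def pieriOp (B m : ℕ) : ℕ → Module.End ℤ (SInf →₀ ℤ)
  | 0 => 1
  | c + 1 => pieriOp B m c * (1 + valueOp B m c)

/-- The exchange relation carries the Monk factor past one value at a time. At `c = B`, beyond all
values concerned, the factor is multiplication by `1 + x_m`. -/
theorem pieriOp_succ {B m : ℕ} (hB : m < B) (c : ℕ) :
    pieriOp B (m + 1) c = pieriOp B m c * (1 + monkOp B m c) := by
  induction c with
  | zero =>
    have : monkOp B m 0 = 0 := by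
      refine Finsupp.lhom_ext' fun w => LinearMap.ext_ring ?_
      simp [monkOp, monkBelow]
    rw [this, add_zero, mul_one]
    rfl
  | succ c ih =>
    rw [pieriOp, pieriOp, ih, mul_assoc, one_add_monkOp_mul hB, ← mul_assoc]

theorem pieriOp_zero (B c : ℕ) : pieriOp B 0 c = 1 := by
  induction c with
  | zero => rfl
  | succ c ih =>
    have : valueOp B 0 c = 0 := by
      refine Finsupp.lhom_ext' fun w => LinearMap.ext_ring ?_
      simp [valueOp, valueCovers]
    rw [pieriOp, ih, this, add_zero, mul_one]

theorem monkBelow_eq_monk {B N m : ℕ} {w : SInf} (hw : w.Fixes N) (hm : m < N) (hB : N ≤ B) :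
    monkBelow B m B w = monk B m w := by
  have hlt : ∀ a, a ≤ m → w.1 a < B := fun a ha => by
    have := hw.apply_lt (show a < N by omega)
    omega
  unfold monkBelow monk signedCover
  rw [if_pos (hlt m le_rfl), Finset.sum_sub_distrib]
  congr 1
  · rw [Finset.range_eq_Ico, ← Finset.sum_Ico_consecutive _ (Nat.zero_le (m + 1)) (by omega),
      Finset.sum_eq_zero (s := Finset.Ico 0 (m + 1)), zero_add]
    intro b hb
    rw [Finset.mem_Ico] at hb
    exact cover_of_le _ (by omega)
  · rw [Finset.range_eq_Ico, Finset.range_eq_Ico,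
      ← Finset.sum_Ico_consecutive (fun b => w.cover b m) (Nat.zero_le m) (show m ≤ B by omega),
      Finset.sum_eq_zero (s := Finset.Ico m B), add_zero]
    · refine Finset.sum_congr rfl fun a ha => ?_
      rw [Finset.mem_Ico] at ha
      rw [if_pos (hlt a (by omega))]
    · intro b hb
      rw [Finset.mem_Ico] at hb
      exact cover_of_le _ (by omega)

/-- The fixed point `N` blocks a cover from reaching further. Thus each multiplication by a variable
adds at most one letter, which is why `N + m < B` suffices in Pieri's rule. -/
theorem Cov.le_of_fixes {N a b : ℕ} {w : SInf} (h : w.Cov a b) (hw : w.Fixes N) (ha : a < N) :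
    b ≤ N := by
  by_contra hb
  have h1 := h.2.2 N ha (by omega)
  rw [hw N le_rfl, hw b (by omega)] at h1
  have := hw.apply_lt ha
  omega

theorem fixes_of_mem_support_cover {N a b : ℕ} {v w : SInf} (hw : w.Fixes N) (ha : a < N)
    (hv : v ∈ (w.cover a b).support) : v.Fixes (N + 1) := by
  classical
  by_cases h : w.Cov a b
  · rw [cover_pos h] at hv
    have := Finsupp.support_single_subset hv
    rw [Finset.mem_singleton] at this
    subst this
    have hb := h.le_of_fixes hw ha
    exact (hw.mono (by omega)).mulSwap (by omega) (by omega)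
  · rw [cover_neg h] at hv
    simp at hv

theorem fixes_of_mem_support_monk {B N k : ℕ} {v w : SInf} (hw : w.Fixes N) (hk : k < N)
    (hv : v ∈ (monk B k w).support) : v.Fixes (N + 1) := by
  classical
  obtain ⟨b, -, hb⟩ := Finset.mem_biUnion.1 (Finsupp.support_finsetSum hv)
  rcases Finset.mem_union.1 (Finsupp.support_sub hb) with h | h
  · exact fixes_of_mem_support_cover hw hk h
  · by_cases hc : w.Cov b k
    · exact fixes_of_mem_support_cover hw (by have := hc.1; omega) h
    · rw [cover_neg hc] at h
      simp at h

/-- Pieri's rule for all elementary symmetric polynomials in the first `m` variables at once. -/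
theorem prod_one_add_X_mul_schubert {B N m : ℕ} {w : SInf} (hw : w.Fixes N) (hm : m ≤ N)
    (hB : N + m < B) :
    (∏ k ∈ Finset.range m, (1 + X k)) * w.schubert =
      expand (pieriOp B m B (Finsupp.single w 1)) := by
  induction m generalizing N w with
  | zero =>
    rw [pieriOp_zero, Finset.prod_range_zero, Module.End.one_apply, expand_single, one_smul,
      one_mul]
  | succ m ih =>
    have hlin : ∀ z : SInf →₀ ℤ, (∀ v ∈ z.support, v.Fixes (N + 1)) →
        (∏ k ∈ Finset.range m, (1 + X k)) * expand z = expand (pieriOp B m B z) := by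
      intro z hz
      conv_lhs => rw [← Finsupp.sum_single z]
      conv_rhs => rw [← Finsupp.sum_single z]
      rw [Finsupp.sum, map_sum, map_sum, map_sum, Finset.mul_sum]
      refine Finset.sum_congr rfl fun v hv => ?_
      have hs : Finsupp.single v (z v) = z v • Finsupp.single v (1 : ℤ) := by
        rw [Finsupp.smul_single, smul_eq_mul, mul_one]
      rw [hs, map_smul, map_smul, map_smul,
        mul_smul_comm, expand_single, one_smul, ih (hz v hv) (by omega) (by omega)]
    rw [pieriOp_succ (by omega), Module.End.mul_apply, LinearMap.add_apply, Module.End.one_apply,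
      monkOp_single, monkBelow_eq_monk hw (by omega) (by omega), map_add, map_add,
      ← hlin (monk B m w) (fun v hv => fixes_of_mem_support_monk hw (by omega) hv),
      ← X_mul_schubert hw (by omega) (by omega), ← ih (hw.mono (Nat.le_succ N)) (by omega)
        (by omega), Finset.prod_range_succ]
    ring

/-! ### Elementary symmetric polynomials and extraction of a single degree. -/

theorem elemSym_zero_left (m : ℕ) : elemSym 0 m = 1 := by simp [elemSym]

theorem elemSym_of_lt {i m : ℕ} (h : m < i) : elemSym i m = 0 := by
  rw [elemSym, Finset.powersetCard_eq_empty.2 (by simpa using h), Finset.sum_empty]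

theorem elemSym_succ (i m : ℕ) :
    elemSym (i + 1) (m + 1) = elemSym (i + 1) m + X m * elemSym i m := by
  classical
  have hm : ∀ t ∈ (Finset.range m).powersetCard i, m ∉ t := fun t ht h => by
    have := (Finset.mem_powersetCard.1 ht).1 h
    simp at this
  rw [elemSym, Finset.range_add_one, Finset.powersetCard_succ_insert (by simp),
    Finset.sum_union, Finset.sum_image, elemSym, elemSym, Finset.mul_sum]
  · congr 1
    exact Finset.sum_congr rfl fun t ht => Finset.prod_insert (hm t ht)
  · intro s hs t ht e
    have := congrArg (fun u => u.erase m) e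
    simpa [Finset.erase_insert (hm s hs), Finset.erase_insert (hm t ht)] using this
  · rw [Finset.disjoint_left]
    intro t ht ht'
    obtain ⟨s, -, rfl⟩ := Finset.mem_image.1 ht'
    have := (Finset.mem_powersetCard.1 ht).1 (Finset.mem_insert_self m s)
    simp at this

theorem isHomogeneous_elemSym (i m : ℕ) : (elemSym i m).IsHomogeneous i := by
  unfold elemSym
  refine IsHomogeneous.sum _ _ _ fun t ht => ?_
  have h : i = ∑ _p ∈ t, 1 := by
    rw [Finset.sum_const, smul_eq_mul, mul_one, (Finset.mem_powersetCard.1 ht).2]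
  rw [h]
  exact IsHomogeneous.prod _ _ _ fun p _ => isHomogeneous_X ℤ p

theorem prod_one_add_X (m : ℕ) :
    ∏ k ∈ Finset.range m, (1 + X k : MvPolynomial ℕ ℤ) =
      ∑ i ∈ Finset.range (m + 1), elemSym i m := by
  rw [Finset.prod_one_add, Finset.sum_powerset, Finset.card_range]
  rfl

/-- The expansion into Schubert polynomials as a linear equivalence. -/
noncomputable def expandEquiv : (SInf →₀ ℤ) ≃ₗ[ℤ] MvPolynomial ℕ ℤ :=
  LinearEquiv.ofBijective expand ⟨expand_injective, expand_surjective⟩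

/-- The coefficients of the expansion of a polynomial into Schubert polynomials. -/
noncomputable def coords : MvPolynomial ℕ ℤ →ₗ[ℤ] (SInf →₀ ℤ) := expandEquiv.symm

theorem expand_coords (f : MvPolynomial ℕ ℤ) : expand (coords f) = f :=
  expandEquiv.apply_symm_apply f

theorem coords_expand (c : SInf →₀ ℤ) : coords (expand c) = c :=
  expandEquiv.symm_apply_apply c

theorem coords_schubert (w : SInf) : coords w.schubert = Finsupp.single w 1 := by
  rw [← coords_expand (Finsupp.single w 1), expand_single, one_smul]

theorem coords_linear (L : MvPolynomial ℕ ℤ →ₗ[ℤ] MvPolynomial ℕ ℤ) (f : MvPolynomial ℕ ℤ)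
    (v : SInf) :
    coords (L f) v = ∑ z ∈ (coords f).support, coords f z * coords (L z.schubert) v := by
  conv_lhs => rw [← expand_coords f, expand, Finsupp.linearCombination_apply, Finsupp.sum]
  simp only [map_sum, map_smul, Finsupp.finsetSum_apply, Finsupp.smul_apply, smul_eq_mul]

theorem homogeneousComponent_expand (n : ℕ) (c : SInf →₀ ℤ) :
    homogeneousComponent n (expand c) = expand (c.filter fun v => v.length = n) := by
  classical
  induction c using Finsupp.induction_linear with
  | zero => rw [Finsupp.filter_zero, map_zero, map_zero]
  | add c d hc hd => rw [map_add, map_add, hc, hd, Finsupp.filter_add, map_add]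
  | single w r =>
    rw [expand_single, map_smul, homogeneousComponent_of_mem w.isHomogeneous_schubert]
    by_cases h : w.length = n
    · rw [Finsupp.filter_single_of_pos (fun v : SInf => v.length = n) h, expand_single,
        if_pos h.symm]
    · rw [Finsupp.filter_single_of_neg (fun v : SInf => v.length = n) h, map_zero,
        if_neg (Ne.symm h), smul_zero]

/-- The product of the `1 + x_k` is the sum of all `e_i`, and `𝔖_v` is homogeneous of degree `ℓ(v)`,
so the length of `v` tells which `e_i` it comes from. -/
theorem coords_elemSym_mul {m : ℕ} {u : SInf} {d : SInf →₀ ℤ}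
    (hd : (∏ k ∈ Finset.range m, (1 + X k)) * u.schubert = expand d) (i : ℕ) (v : SInf) :
    coords (elemSym i m * u.schubert) v = if v.length = i + u.length then d v else 0 := by
  classical
  have h : elemSym i m * u.schubert = expand (d.filter fun v => v.length = i + u.length) := by
    rw [← homogeneousComponent_expand, ← hd, prod_one_add_X, Finset.sum_mul, map_sum]
    have hc : ∀ i' ∈ Finset.range (m + 1),
        homogeneousComponent (i + u.length) (elemSym i' m * u.schubert) =
          if i = i' then elemSym i' m * u.schubert else 0 := by
      intro i' _
      rw [homogeneousComponent_of_mem ((isHomogeneous_elemSym i' m).mul u.isHomogeneous_schubert)]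
      simp only [Nat.add_right_cancel_iff]
    rw [Finset.sum_congr rfl hc, Finset.sum_ite_eq]
    split_ifs with hi
    · rfl
    · rw [Finset.mem_range] at hi
      rw [elemSym_of_lt (by omega), zero_mul]
  rw [h, coords_expand, Finsupp.filter_apply]

/-! ### Nonnegativity, and the last step leading to a new permutation. -/

theorem cover_nonneg (w : SInf) (a b : ℕ) : 0 ≤ w.cover a b := by
  by_cases h : w.Cov a b
  · rw [cover_pos h]
    exact Finsupp.single_nonneg.2 zero_le_one
  · rw [cover_neg h]

theorem valueOp_nonneg (B m c : ℕ) {z : SInf →₀ ℤ} (hz : 0 ≤ z) : 0 ≤ valueOp B m c z := by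
  rw [valueOp, Finsupp.linearCombination_apply, Finsupp.sum]
  refine Finset.sum_nonneg fun w _ => smul_nonneg (hz w) ?_
  unfold valueCovers
  split_ifs
  · exact Finset.sum_nonneg fun b _ => cover_nonneg _ _ _
  · exact le_rfl

theorem exists_of_valueOp_ne_zero {B m c : ℕ} {z : SInf →₀ ℤ} {v : SInf}
    (hv : valueOp B m c z v ≠ 0) : ∃ y b, z y ≠ 0 ∧ y.1.symm c < m ∧ m ≤ b ∧
      y.Cov (y.1.symm c) b ∧ v = y.mulSwap (y.1.symm c) b := by
  classical
  rw [valueOp, Finsupp.linearCombination_apply, Finsupp.sum, Finsupp.finsetSum_apply] at hv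
  obtain ⟨y, hy, hne⟩ := Finset.exists_ne_zero_of_sum_ne_zero hv
  rw [Finsupp.smul_apply, smul_eq_mul, valueCovers] at hne
  have hne := right_ne_zero_of_mul hne
  split_ifs at hne with h
  · rw [Finsupp.finsetSum_apply] at hne
    obtain ⟨b, hb, hne⟩ := Finset.exists_ne_zero_of_sum_ne_zero hne
    by_cases hc : y.Cov (y.1.symm c) b
    · rw [cover_pos hc, Finsupp.single_apply_ne_zero] at hne
      exact ⟨y, b, Finsupp.mem_support_iff.1 hy, h, (Finset.mem_Ico.1 hb).1, hc, hne.1⟩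
    · rw [cover_neg hc] at hne
      exact absurd rfl hne
  · exact absurd rfl hne

theorem pieriOp_nonneg (B m c : ℕ) {z : SInf →₀ ℤ} (hz : 0 ≤ z) : 0 ≤ pieriOp B m c z := by
  induction c generalizing z with
  | zero => exact hz
  | succ c ih =>
    rw [pieriOp, Module.End.mul_apply]
    exact ih (add_nonneg hz (valueOp_nonneg B m c hz))

/-- On permutations fixing the first letter, the operator for the value `0` acts last. -/
theorem pieriOp_eq_of_fixes_zero {B m : ℕ} (c : ℕ) {z : SInf →₀ ℤ} (hz : 0 ≤ z)
    (h0 : ∀ y, z y ≠ 0 → y.1 0 = 0) : ∃ z' : SInf →₀ ℤ, 0 ≤ z' ∧ (∀ y, z' y ≠ 0 → y.1 0 = 0) ∧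
      pieriOp B m (c + 1) z = z' + valueOp B m 0 z' := by
  induction c generalizing z with
  | zero => exact ⟨z, hz, h0, rfl⟩
  | succ c ih =>
    rw [pieriOp, Module.End.mul_apply]
    refine ih (add_nonneg hz (valueOp_nonneg B m (c + 1) hz)) fun y hy => ?_
    by_cases h : z y = 0
    · have hy' : valueOp B m (c + 1) z y ≠ 0 := by
        intro e
        apply hy
        change z y + valueOp B m (c + 1) z y = 0
        rw [h, e, add_zero]
      -- Exchanging the value `c + 1` with a larger one leaves the value `0` at position `0`.
      obtain ⟨x, b, hx, -, -, hc, rfl⟩ := exists_of_valueOp_ne_zero hy'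
      have hx0 := h0 x hx
      have hne : 0 ≠ x.1.symm (c + 1) := fun e => by
        have := Equiv.apply_symm_apply x.1 (c + 1)
        rw [← e] at this
        omega
      rw [mulSwap_of_ne _ hne (by have := hc.1; omega), hx0]
    · exact h0 y h

/-- The consequences of Pieri's rule that are needed: the coefficients are nonnegative, and a
permutation that appears newly arises by moving the first letter in the last step. -/
theorem exists_pieri (m : ℕ) (u : SInf) : ∃ d : SInf →₀ ℤ,
    (∏ k ∈ Finset.range m, (1 + X k)) * u.schubert = expand d ∧ 0 ≤ d ∧
    (u.1 0 = 0 → ∀ v, d v ≠ 0 → v.1 0 ≠ 0 → ∃ y b, d y ≠ 0 ∧ y.1 0 = 0 ∧ m ≤ b ∧ y.Cov 0 b ∧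
      v = y.mulSwap 0 b) := by
  obtain ⟨N, hN⟩ := u.2
  have hu : u.Fixes (N + m) := fun p hp => hN p (by omega)
  have hs : (0 : SInf →₀ ℤ) ≤ Finsupp.single u 1 := Finsupp.single_nonneg.2 zero_le_one
  refine ⟨_, prod_one_add_X_mul_schubert (B := N + m + m + 1) hu (by omega) (by omega),
    pieriOp_nonneg _ _ _ hs, fun h0 v hv hv0 => ?_⟩
  obtain ⟨z, hz, hz0, e⟩ := pieriOp_eq_of_fixes_zero (B := N + m + m + 1) (m := m) (N + m + m) hs
    fun y hy => by
      classical
      rw [Finsupp.single_apply_ne_zero] at hy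
      rw [hy.1, h0]
  rw [e] at hv ⊢
  have hzv : z v = 0 := by
    by_contra h
    exact hv0 (hz0 v h)
  rw [Finsupp.add_apply, hzv, zero_add] at hv
  obtain ⟨y, b, hy, -, hb, hc, rfl⟩ := exists_of_valueOp_ne_zero hv
  have hy0 := hz0 y hy
  have hsymm : y.1.symm 0 = 0 := by rw [Equiv.symm_apply_eq, hy0]
  rw [hsymm] at hc ⊢
  refine ⟨y, b, ?_, hy0, hb, hc, rfl⟩
  -- Both summands at `y` are nonnegative, so the nonzero coefficient in `z` cannot be cancelled.
  have h1 := hz y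
  have h2 := valueOp_nonneg (N + m + m + 1) m 0 hz y
  rw [Finsupp.zero_apply] at h1 h2
  rw [Finsupp.add_apply]
  omega

theorem coords_elemSym_mul_nonneg (i m : ℕ) (u v : SInf) :
    0 ≤ coords (elemSym i m * u.schubert) v := by
  obtain ⟨d, hd, hd0, -⟩ := exists_pieri m u
  rw [coords_elemSym_mul hd]
  split_ifs
  · exact hd0 v
  · exact le_rfl

/-- The final cover raises the length by one, so its source belongs to degree one less, that is to
`e_{i-1}`. -/
theorem exists_cover_of_coords_ne_zero {i m : ℕ} {u v : SInf} (hu : u.1 0 = 0)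
    (hv : coords (elemSym i m * u.schubert) v ≠ 0) (hv0 : v.1 0 ≠ 0) :
    ∃ i', i = i' + 1 ∧ ∃ y b, coords (elemSym i' m * u.schubert) y ≠ 0 ∧ y.1 0 = 0 ∧ m ≤ b ∧
      y.Cov 0 b := by
  cases i with
  | zero =>
    rw [elemSym_zero_left, one_mul, coords_schubert, Finsupp.single_apply_ne_zero] at hv
    rw [hv.1] at hv0
    exact absurd hu hv0
  | succ i =>
    obtain ⟨d, hd, -, hd'⟩ := exists_pieri m u
    rw [coords_elemSym_mul hd] at hv
    split_ifs at hv with hl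
    · obtain ⟨y, b, hy, hy0, hb, hc, rfl⟩ := hd' hu v hv hv0
      refine ⟨i, rfl, y, b, ?_, hy0, hb, hc⟩
      have := hc.length
      rwa [coords_elemSym_mul hd, if_pos (by omega)]
    · exact absurd rfl hv

/-! ### The derivation `nabla` and raising the degree. -/

/-- The derivation `∑ₖ ∂/∂xₖ`. -/
noncomputable def nabla : Derivation ℤ (MvPolynomial ℕ ℤ) (MvPolynomial ℕ ℤ) :=
  mkDerivation ℤ fun _ => 1

theorem nabla_X (k : ℕ) : nabla (X k) = 1 := mkDerivation_X ℤ _ k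

theorem nabla_swapVar (a : ℕ) (f : MvPolynomial ℕ ℤ) :
    nabla (swapVar a f) = swapVar a (nabla f) := by
  induction f using MvPolynomial.induction_on with
  | C r => simp [swapVar, nabla]
  | add f g hf hg => rw [map_add, map_add, map_add, map_add, hf, hg]
  | mul_X f k hf =>
    rw [map_mul, Derivation.leibniz, Derivation.leibniz, hf, swapVar_X, nabla_X, nabla_X]
    simp [swapVar_X]

/-- Each `i`-subset of `m` variables arises from `m - i` subsets of size `i + 1` by omitting a
variable. -/
theorem nabla_elemSym (i m : ℕ) :
    nabla (elemSym (i + 1) m) = C ((m : ℤ) - i) * elemSym i m := by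
  induction m generalizing i with
  | zero =>
    rw [elemSym_of_lt (by omega), map_zero]
    cases i with
    | zero => simp
    | succ i => rw [elemSym_of_lt (by omega), mul_zero]
  | succ m ih =>
    rw [elemSym_succ, map_add, Derivation.leibniz, nabla_X, ih]
    cases i with
    | zero =>
      simp [elemSym_zero_left]
    | succ i =>
      rw [ih, elemSym_succ]
      simp only [smul_eq_mul, map_sub, map_natCast, Nat.cast_add, Nat.cast_one, map_add, map_one]
      ring

theorem constantCoeff_nabla_nonneg {f : MvPolynomial ℕ ℤ} (hf : ∀ d, 0 ≤ coeff d f) :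
    0 ≤ constantCoeff (nabla f) := by
  rw [f.as_sum, map_sum, map_sum]
  refine Finset.sum_nonneg fun d _ => ?_
  rw [nabla, mkDerivation_monomial, smul_eq_C_mul, map_mul, constantCoeff_C, Finsupp.sum, map_sum]
  refine mul_nonneg (hf d) (Finset.sum_nonneg fun k _ => ?_)
  rw [smul_eq_mul, mul_one, constantCoeff_monomial]
  split_ifs <;> simp

/-- The expansion of `∇ 𝔖_w` has nonnegative coefficients, and it consists of permutations fixing
the first letter if `w` does. -/
theorem coords_nabla_schubert (v w : SInf) : 0 ≤ coords (nabla w.schubert) v ∧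
    (w.1 0 = 0 → v.1 0 ≠ 0 → coords (nabla w.schubert) v = 0) := by
  induction v using induction_descent generalizing w with
  | _ v ih =>
    by_cases hv : v = id
    · subst hv
      refine ⟨?_, fun _ h => absurd (id_apply 0) h⟩
      rw [← constantCoeff_expand, expand_coords]
      exact constantCoeff_nabla_nonneg w.coeff_schubert_nonneg
    · obtain ⟨a, ha⟩ := v.exists_descent hv
      -- As `nabla` kills `x_a - x_{a+1}`, it commutes with `∂_a`; the coefficient at `v` becomes
      -- one at the shorter `v s_a`.
      have h1 : nabla w.schubert - swapVar a (nabla w.schubert) = (X a - X (a + 1)) *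
          nabla (if w.1 (a + 1) < w.1 a then (w.mulSwap a (a + 1)).schubert else 0) := by
        rw [← nabla_swapVar, ← map_sub, schubert_sub_swapVar, Derivation.leibniz, map_sub, nabla_X,
          nabla_X, sub_self, smul_zero, add_zero, smul_eq_mul]
      rw [← expand_coords (nabla w.schubert)] at h1
      have h2 := expand_descend_of_sub h1
      have h3 : descend a (coords (nabla w.schubert)) (v.mulSwap a (a + 1)) =
          coords (nabla w.schubert) v := by
        rw [descend_apply, mulSwap_left, mulSwap_right, if_pos ha, mulSwap_mulSwap]
      rw [← coords_expand (descend a _), h2] at h3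
      rw [← h3]
      split_ifs with hw
      · obtain ⟨e1, e2⟩ := ih a ha (w.mulSwap a (a + 1))
        refine ⟨e1, fun hw0 hv0 => e2 ?_ ?_⟩
        -- A permutation fixing the first letter has no descent there, so `s_a` leaves the first
        -- position alone.
        · have : a ≠ 0 := by
            rintro rfl
            omega
          rwa [mulSwap_of_ne _ (by omega) (by omega)]
        · by_cases ha0 : a = 0
          · subst ha0
            omega
          · rwa [mulSwap_of_ne _ (by omega) (by omega)]
      · simp

/-- Apply `nabla` to `e_{i+1} 𝔖_u`: the result involves only permutations fixing the first letter,
and it is `(m - i) e_i 𝔖_u` plus a nonnegative combination. With `m - i > 0` nothing can cancel. -/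
theorem coords_elemSym_eq_zero_of_succ {i m : ℕ} (him : i < m) {u : SInf}
    (h : ∀ v : SInf, v.1 0 ≠ 0 → coords (elemSym (i + 1) m * u.schubert) v = 0) {v : SInf}
    (hv : v.1 0 ≠ 0) : coords (elemSym i m * u.schubert) v = 0 := by
  have h1 : coords (nabla (elemSym (i + 1) m * u.schubert)) v = 0 := by
    have := coords_linear (nabla : MvPolynomial ℕ ℤ →ₗ[ℤ] MvPolynomial ℕ ℤ)
      (elemSym (i + 1) m * u.schubert) v
    rw [Derivation.coeFn_coe] at this
    rw [this]
    refine Finset.sum_eq_zero fun z hz => ?_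
    rw [Finsupp.mem_support_iff] at hz
    have hz0 : z.1 0 = 0 := by
      by_contra hz0
      exact hz (h z hz0)
    rw [(coords_nabla_schubert v z).2 hz0 hv, mul_zero]
  have h2 : 0 ≤ coords (elemSym (i + 1) m * nabla u.schubert) v := by
    have := coords_linear (LinearMap.mulLeft ℤ (elemSym (i + 1) m)) (nabla u.schubert) v
    simp only [LinearMap.mulLeft_apply] at this
    rw [this]
    exact Finset.sum_nonneg fun z _ => mul_nonneg (coords_nabla_schubert z u).1
      (coords_elemSym_mul_nonneg _ _ _ _)
  have h3 := coords_elemSym_mul_nonneg i m u v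
  have h4 : nabla (elemSym (i + 1) m * u.schubert) = elemSym (i + 1) m * nabla u.schubert +
      ((m : ℤ) - i) • (elemSym i m * u.schubert) := by
    rw [Derivation.leibniz, nabla_elemSym, smul_eq_C_mul, smul_eq_mul, smul_eq_mul]
    ring
  rw [h4, map_add, map_smul, Finsupp.add_apply, Finsupp.smul_apply, smul_eq_mul] at h1
  have hpos : (0 : ℤ) < (m : ℤ) - i := by omega
  nlinarith

/-! ### The shift `1 × u` and the substitution `dropVar`. -/

theorem onePow_one_zero (u : SInf) : (u.onePow 1).1 0 = 0 := rfl

theorem onePow_one_succ (u : SInf) (p : ℕ) : (u.onePow 1).1 (p + 1) = u.1 p + 1 := rfl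

theorem exists_onePow_one (v : SInf) (hv : v.1 0 = 0) : ∃ u : SInf, v = u.onePow 1 := by
  have h1 : ∀ p, v.1 (p + 1) ≠ 0 := fun p => by
    rw [← hv]
    exact v.apply_ne (by omega)
  have h2 : ∀ p, v.1.symm (p + 1) ≠ 0 := fun p e => by
    rw [Equiv.symm_apply_eq, hv] at e
    omega
  obtain ⟨N, hN⟩ := v.2
  refine ⟨⟨⟨fun p => v.1 (p + 1) - 1, fun p => v.1.symm (p + 1) - 1, fun p => ?_, fun p => ?_⟩,
    N, fun p hp => ?_⟩, ?_⟩
  · have := h1 p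
    simp only
    rw [Nat.sub_add_cancel (by omega), Equiv.symm_apply_apply, Nat.add_sub_cancel]
  · have := h2 p
    simp only
    rw [Nat.sub_add_cancel (by omega), Equiv.apply_symm_apply, Nat.add_sub_cancel]
  · simp only [Equiv.coe_fn_mk]
    rw [hN (p + 1) (by omega), Nat.add_sub_cancel]
  · apply ext_apply
    intro p
    cases p with
    | zero => exact hv
    | succ p =>
      have := h1 p
      change v.1 (p + 1) = v.1 (p + 1) - 1 + 1
      omega

theorem onePow_one_injective : Function.Injective (onePow 1) := by
  intro u v h
  apply ext_apply
  intro p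
  have := congrArg (fun w : SInf => w.1 (p + 1)) h
  simp only [onePow_one_succ] at this
  omega

theorem onePow_zero (w : SInf) : w.onePow 0 = w := ext_apply fun _ => rfl

theorem onePow_one_onePow (k : ℕ) (w : SInf) : (w.onePow k).onePow 1 = w.onePow (k + 1) := by
  apply ext_apply
  intro p
  cases p with
  | zero => rw [onePow_one_zero]; simp [onePow]
  | succ p =>
    rw [onePow_one_succ]
    simp only [onePow, Equiv.coe_fn_mk]
    by_cases h : p < k
    · rw [if_pos h, if_pos (by omega)]
    · rw [if_neg h, if_neg (by omega), Nat.add_sub_add_right]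
      omega

theorem onePow_one_mulSwap (u : SInf) (a b : ℕ) :
    (u.onePow 1).mulSwap (a + 1) (b + 1) = (u.mulSwap a b).onePow 1 := by
  apply ext_apply
  intro p
  cases p with
  | zero => rw [mulSwap_of_ne _ (by omega) (by omega)]; rfl
  | succ p =>
    simp only [onePow_one_succ, mulSwap_ite, Nat.add_right_cancel_iff]
    split_ifs <;> rfl

theorem onePow_one_id : id.onePow 1 = id := by
  apply ext_apply
  intro p
  cases p <;> rfl

/-- The substitution `x₀ = 0`, `x_{k+1} = x_k`. -/
noncomputable def dropVar : MvPolynomial ℕ ℤ →ₐ[ℤ] MvPolynomial ℕ ℤ :=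
  aeval fun k => Nat.casesOn k 0 X

theorem dropVar_X_zero : dropVar (X 0) = 0 := aeval_X _ 0

theorem dropVar_X_succ (k : ℕ) : dropVar (X (k + 1)) = X k := aeval_X _ (k + 1)

theorem dropVar_swapVar (a : ℕ) (f : MvPolynomial ℕ ℤ) :
    dropVar (swapVar (a + 1) f) = swapVar a (dropVar f) := by
  have h : dropVar.comp (swapVar (a + 1)) = (swapVar a).comp dropVar := by
    refine algHom_ext fun k => ?_
    rw [AlgHom.comp_apply, AlgHom.comp_apply, swapVar_X]
    cases k with
    | zero => rw [Equiv.swap_apply_of_ne_of_ne (by omega) (by omega), dropVar_X_zero, map_zero]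
    | succ k =>
      rw [dropVar_X_succ, swapVar_X, Equiv.swap_apply_def, Equiv.swap_apply_def]
      simp only [Nat.add_right_cancel_iff]
      split_ifs <;> exact dropVar_X_succ _
  exact congrArg (fun F => F f) h

theorem constantCoeff_dropVar (f : MvPolynomial ℕ ℤ) :
    constantCoeff (dropVar f) = constantCoeff f := by
  have h : constantCoeff.comp (dropVar : MvPolynomial ℕ ℤ →+* MvPolynomial ℕ ℤ) =
      constantCoeff := by
    refine ringHom_ext (fun r => by simp) fun k => ?_
    cases k with
    | zero => simp [dropVar_X_zero]
    | succ k => simp [dropVar_X_succ]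
  exact congrArg (fun F => F f) h

theorem dropVar_schubert_sub (v : SInf) (a : ℕ) :
    dropVar v.schubert - swapVar a (dropVar v.schubert) = (X a - X (a + 1)) *
      if v.1 (a + 2) < v.1 (a + 1) then dropVar (v.mulSwap (a + 1) (a + 2)).schubert else 0 := by
  rw [← dropVar_swapVar, ← map_sub, schubert_sub_swapVar, map_mul, map_sub, dropVar_X_succ,
    dropVar_X_succ, apply_ite dropVar, map_zero]

/-- `dropVar` turns `∂_{a+1}` into `∂_a`, and descents at `a + 1` do not affect position `0`.
Inductively all divided differences vanish, and the constant term is `0` since `v` is not the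
identity. -/
theorem dropVar_schubert_of_ne (v : SInf) (hv : v.1 0 ≠ 0) : dropVar v.schubert = 0 := by
  induction v using induction_descent with
  | _ v ih =>
    refine eq_zero_of_swapVar (fun a => ?_) ?_
    · have h := dropVar_schubert_sub v a
      have h' : (if v.1 (a + 2) < v.1 (a + 1) then
          dropVar (v.mulSwap (a + 1) (a + 2)).schubert else 0) = 0 := by
        split_ifs with hd
        · exact ih (a + 1) hd (by rwa [mulSwap_of_ne _ (by omega) (by omega)])
        · rfl
      rw [h', mul_zero, sub_eq_zero] at h
      exact h.symm
    · rw [constantCoeff_dropVar, constantCoeff_schubert]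
      rintro rfl
      exact hv rfl

theorem dropVar_schubert_onePow (u : SInf) : dropVar (u.onePow 1).schubert = u.schubert := by
  induction u using induction_descent with
  | _ u ih =>
    rw [← sub_eq_zero]
    refine eq_zero_of_swapVar (fun a => ?_) ?_
    · have h1 := dropVar_schubert_sub (u.onePow 1) a
      have h2 := schubert_sub_swapVar u a
      have h3 : (if (u.onePow 1).1 (a + 2) < (u.onePow 1).1 (a + 1) then
          dropVar ((u.onePow 1).mulSwap (a + 1) (a + 2)).schubert else 0) =
          if u.1 (a + 1) < u.1 a then (u.mulSwap a (a + 1)).schubert else 0 := by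
        rw [onePow_one_succ, onePow_one_succ]
        simp only [Nat.add_lt_add_iff_right]
        split_ifs with hd
        · rw [onePow_one_mulSwap, ih a hd]
        · rfl
      rw [h3, ← h2] at h1
      rw [map_sub]
      linear_combination -h1
    · rw [map_sub, constantCoeff_dropVar]
      by_cases hu : u = id
      · subst hu
        rw [onePow_one_id, sub_self]
      · rw [constantCoeff_schubert hu, constantCoeff_schubert, sub_zero]
        intro e
        rw [← onePow_one_id] at e
        exact hu (onePow_one_injective e)

theorem dropVar_elemSym (i m : ℕ) : dropVar (elemSym i (m + 1)) = elemSym i m := by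
  induction m generalizing i with
  | zero =>
    cases i with
    | zero => rw [elemSym_zero_left, elemSym_zero_left, map_one]
    | succ i =>
      rw [elemSym_succ, map_add, map_mul, dropVar_X_zero, zero_mul, add_zero,
        elemSym_of_lt (by omega), map_zero]
  | succ m ih =>
    cases i with
    | zero => rw [elemSym_zero_left, elemSym_zero_left, map_one]
    | succ i => rw [elemSym_succ, map_add, map_mul, ih, ih, dropVar_X_succ, elemSym_succ]

theorem coords_dropVar (f : MvPolynomial ℕ ℤ) (v : SInf) :
    coords (dropVar f) v = coords f (v.onePow 1) := by
  classical
  obtain ⟨c, rfl⟩ := expand_surjective f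
  rw [coords_expand]
  induction c using Finsupp.induction_linear with
  | zero => simp
  | add c d hc hd => rw [map_add, map_add, map_add, Finsupp.add_apply, Finsupp.add_apply, hc, hd]
  | single z r =>
    rw [expand_single, map_smul, map_smul, Finsupp.smul_apply, Finsupp.single_apply, smul_eq_mul]
    by_cases hz : z.1 0 = 0
    · obtain ⟨u, rfl⟩ := exists_onePow_one z hz
      rw [dropVar_schubert_onePow, coords_schubert, Finsupp.single_apply,
        onePow_one_injective.eq_iff]
      split_ifs <;> simp
    · rw [dropVar_schubert_of_ne z hz, if_neg]
      · simp
      · rintro rfl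
        exact hz rfl

/-! ### New permutations and the strong stable property. -/

/-- The coefficients of the expansion of `e_i^{j+k} 𝔖_{1ᵏ × w}`. -/
noncomputable def stableCoords (i j : ℕ) (w : SInf) (k : ℕ) : SInf →₀ ℤ :=
  coords (elemSym i (j + k) * (w.onePow k).schubert)

theorem stableCoords_succ (i j : ℕ) (w : SInf) (k : ℕ) (v : SInf) :
    stableCoords i j w (k + 1) (v.onePow 1) = stableCoords i j w k v := by
  rw [stableCoords, ← coords_dropVar, map_mul, ← add_assoc, dropVar_elemSym, ← onePow_one_onePow,
    dropVar_schubert_onePow, stableCoords]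

/-- A permutation that moves the first letter appears in the `k`-th expansion. -/
def HasNew (i j : ℕ) (w : SInf) (k : ℕ) : Prop :=
  ∃ v : SInf, stableCoords i j w k v ≠ 0 ∧ v.1 0 ≠ 0

theorem HasNew.exists_pred {i j : ℕ} {w : SInf} {k : ℕ} (h : HasNew i j w (k + 1)) :
    ∃ i', i = i' + 1 ∧ (1 ≤ k → HasNew i' j w k) := by
  obtain ⟨v, hv, hv0⟩ := h
  obtain ⟨i', hi, y, b, hy, hy0, hb, hc⟩ := exists_cover_of_coords_ne_zero
    (by rw [← onePow_one_onePow]; rfl) hv hv0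
  refine ⟨i', hi, fun hk => ?_⟩
  obtain ⟨y, rfl⟩ := exists_onePow_one y hy0
  refine ⟨y, ?_, fun h0 => ?_⟩
  · rw [← stableCoords_succ]
    exact hy
  -- Position `1` lies strictly between `0` and `b`, as `b ≥ j + k + 1` and `k ≥ 1`. If `y` fixed
  -- its first letter, the value `1` there would violate the cover condition.
  · have h1 := hc.2.2 1 (by omega) (by omega)
    have h2 := hc.2.1
    have h3 : (y.onePow 1).1 1 = 1 := by
      change y.1 0 + 1 = 1
      rw [h0]
    rw [onePow_one_zero] at h1 h2
    omega

theorem HasNew.le {i j : ℕ} {w : SInf} {k : ℕ} (h : HasNew i j w (k + 1)) : k + 1 ≤ i := by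
  induction k generalizing i with
  | zero =>
    obtain ⟨i', hi, -⟩ := h.exists_pred
    omega
  | succ k ih =>
    obtain ⟨i', hi, h'⟩ := h.exists_pred
    have := ih (h' (by omega))
    omega

theorem HasNew.succ_left {i j : ℕ} {w : SInf} {k : ℕ} (hi : i < j + k)
    (h : HasNew i j w k) : HasNew (i + 1) j w k := by
  obtain ⟨v, hv, hv0⟩ := h
  by_contra hn
  refine hv (coords_elemSym_eq_zero_of_succ hi (fun v' hv' => ?_) hv0)
  by_contra hne
  exact hn ⟨v', hne, hv'⟩

/-- Pieri's rule lowers both `i` and `k`, and `nabla` raises `i` again. The latter needs `i - 1 < j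
+ k`, which is where `i ≤ j` enters. -/
theorem HasNew.pred {i j : ℕ} (hij : i ≤ j) {w : SInf} {k : ℕ} (hk : 1 ≤ k)
    (h : HasNew i j w (k + 1)) : HasNew i j w k := by
  obtain ⟨i', rfl, h'⟩ := h.exists_pred
  exact (h' hk).succ_left (by omega)

theorem mem_newPerms_succ {i j : ℕ} {w : SInf} {k : ℕ} {v : SInf} :
    v ∈ newPerms (stableCoords i j w) (k + 1) ↔
      stableCoords i j w (k + 1) v ≠ 0 ∧ v.1 0 ≠ 0 := by
  classical
  rw [newPerms, Finset.mem_sdiff, Finsupp.mem_support_iff, Finset.mem_image]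
  refine and_congr_right fun hv => ?_
  constructor
  · intro h h0
    obtain ⟨u, rfl⟩ := exists_onePow_one v h0
    refine h ⟨u, ?_, rfl⟩
    rwa [Finsupp.mem_support_iff, ← stableCoords_succ]
  · rintro h ⟨u, -, rfl⟩
    exact h rfl

theorem newPerms_nonempty_iff {i j : ℕ} {w : SInf} {k : ℕ} :
    (newPerms (stableCoords i j w) (k + 1)).Nonempty ↔ HasNew i j w (k + 1) :=
  exists_congr fun _ => mem_newPerms_succ

/-- `g` is arbitrary so that the induction hypothesis applies to `v ↦ g (1 × v)`. -/
theorem sum_stableCoords (i j : ℕ) (w : SInf) (k : ℕ) (g : SInf → MvPolynomial ℕ ℤ) :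
    ∑ v ∈ (stableCoords i j w k).support, C (stableCoords i j w k v) * g v =
      ∑ s ∈ Finset.range (k + 1), ∑ v ∈ newPerms (stableCoords i j w) s,
        C (stableCoords i j w s v) * g (v.onePow (k - s)) := by
  classical
  induction k generalizing g with
  | zero =>
    rw [Finset.sum_range_one]
    simp only [newPerms, Nat.sub_zero, onePow_zero]
  | succ k ih =>
    have hsub : (stableCoords i j w k).support.image (onePow 1) ⊆
        (stableCoords i j w (k + 1)).support := by
      intro v hv
      obtain ⟨u, hu, rfl⟩ := Finset.mem_image.1 hv
      rw [Finsupp.mem_support_iff] at hu ⊢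
      rwa [stableCoords_succ]
    rw [← Finset.sum_sdiff hsub, Finset.sum_range_succ, add_comm]
    congr 1
    · rw [Finset.sum_image fun u _ v _ h => onePow_one_injective h]
      simp only [stableCoords_succ]
      rw [ih fun v => g (v.onePow 1)]
      refine Finset.sum_congr rfl fun s hs => Finset.sum_congr rfl fun v _ => ?_
      rw [Finset.mem_range] at hs
      rw [onePow_one_onePow, show k - s + 1 = k + 1 - s by omega]
    · simp only [Nat.sub_self, onePow_zero]
      refine Finset.sum_congr ?_ fun _ _ => rfl
      ext v
      simp only [newPerms, Finset.mem_sdiff]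

end SInf

open SInf in
theorem mainTheorem6 (i j : ℕ) (hij : i ≤ j) (w : SInf) :
    ∃ c : ℕ → SInf →₀ ℤ,
      (∀ k, IsSchubertExpansion (elemSym i (j + k) * (w.onePow k).schubert) (c k) ∧
        ∀ c', IsSchubertExpansion (elemSym i (j + k) * (w.onePow k).schubert) c' → c' = c k) ∧
      (∀ k v, c (k + 1) (v.onePow 1) = c k v) ∧
      (∀ k, 1 ≤ k → ∀ v ∈ newPerms c k, v.1 0 ≠ 0) ∧
      ∃ r : ℕ,
        (∀ k, r ≤ k →
          elemSym i (j + k) * (w.onePow k).schubert =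
            ∑ s ∈ Finset.range (r + 1), ∑ v ∈ newPerms c s,
              MvPolynomial.C (c s v) * (v.onePow (k - s)).schubert) ∧
        (∀ s, 1 ≤ s → s ≤ r → (newPerms c s).Nonempty) ∧
        (∀ s, r < s → newPerms c s = ∅) := by
  classical
  have hexp : ∀ k, IsSchubertExpansion (elemSym i (j + k) * (w.onePow k).schubert)
      (stableCoords i j w k) := fun k => by
    rw [isSchubertExpansion_iff, stableCoords, expand_coords]
  -- This is the `r` of the theorem: the largest positive `k ≤ i` with a new permutation, or `0` if
  -- there is none. By `HasNew.le` no larger `k` needs to be searched.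
  have hempty : ∀ s, Nat.findGreatest (HasNew i j w) i < s →
      newPerms (stableCoords i j w) s = ∅ := by
    intro s hs
    obtain ⟨s, rfl⟩ : ∃ s', s = s' + 1 := ⟨s - 1, by omega⟩
    rw [← Finset.not_nonempty_iff_eq_empty, newPerms_nonempty_iff]
    exact fun h => absurd (Nat.le_findGreatest h.le h) (by omega)
  refine ⟨stableCoords i j w, fun k => ⟨hexp k, fun c' hc' => ?_⟩, stableCoords_succ i j w, ?_,
    Nat.findGreatest (HasNew i j w) i, fun k hk => ?_, fun s hs hsr => ?_, hempty⟩
  · rw [isSchubertExpansion_iff] at hc'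
    rw [stableCoords, hc', coords_expand]
  · intro k hk v hv
    obtain ⟨k, rfl⟩ : ∃ k', k = k' + 1 := ⟨k - 1, by omega⟩
    exact (mem_newPerms_succ.1 hv).2
  · rw [(hexp k : _ = _), sum_stableCoords i j w k schubert, eq_comm]
    refine Finset.sum_subset (fun s hs => ?_) fun s _ hs => ?_
    · rw [Finset.mem_range] at hs ⊢
      omega
    · rw [Finset.mem_range] at hs
      rw [hempty s (by omega), Finset.sum_empty]
  · have htop : HasNew i j w (Nat.findGreatest (HasNew i j w) i) :=
      Nat.findGreatest_of_ne_zero rfl (by omega)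
    have hdown : HasNew i j w s := by
      refine Nat.decreasingInduction' (fun k _ hk h => ?_) hsr htop
      exact h.pred hij (by omega)
    obtain ⟨s, rfl⟩ : ∃ s', s = s' + 1 := ⟨s - 1, by omega⟩
    exact newPerms_nonempty_iff.2 hdown
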